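/- Gaussian sequence model: for $n\ge 1$ and $f=(f_k)_{k\ge1}$ one observes $X^{(n)}=(X_1,X_2,\dots)$ with $X_k\sim\mathcal N(f_k,1/n)$ independent; let $P_f$ denote the law of $X^{(n)}$ and $E_f$ the expectation under it. For a scale sequence $(\sigma_k)_{k\ge1}$, the series prior $\Pi$ is the law of $f=(\sigma_k\zeta_k)_{k\ge1}$, where the $\zeta_k$ are i.i.d. with density $h$ on $\mathbb R$, and the posterior $\Pi[\,\cdot\mid X^{(n)}]$ is the conditional distribution of $f$ given $X^{(n)}$ when $f\sim\Pi$ and $X^{(n)}\mid f\sim P_f$. Assume that $h$ is symmetric, positive, bounded and decreasing on $[0,\infty)$, that for some constants $c_1>0$, $\kappa\ge0$, $$\log\bigl(1/h(x)\bigr)\le c_1\bigl(1+\log^{1+\kappa}(1+x)\bigr)\qquad\text{for all }x\ge0,$$ and that $\int_{\mathbb R}x^2h(x)\,dx<\infty$. For $\beta,L>0$ let $S^\beta(L)=\{f=(f_k)_{k\ge1}:\ \sum_{k\ge1}k^{2\beta}f_k^2\le L^2\}$, and let $\|\cdot\|_2$ be the $\ell^2$ norm. (i) Let $\sigma_k=e^{-(\log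 k)^2}$. For every $\beta>0$ there is $d>0$ such that for every $L>0$ and every $f_0\in S^\beta(L)$, as $n\to\infty$, $$E_{f_0}\,\Pi\bigl[\{f:\ \|f-f_0\|_2>(\log n)^d\,n^{-\beta/(2\beta+1)}\}\,\big|\,X^{(n)}\bigr]\to0.\qquad(*)$$ (ii) Let $\sigma_k=k^{-1/2-\alpha}$ with $\alpha>0$. For every $0<\beta\le\alpha$ there is $d>0$ such that $(*)$ holds for every $L>0$ and every $f_0\in S^\beta(L)$. (iii) In (i) and (ii), $(*)$ also holds, with the same $d$, when for each $n$ the prior is replaced by its truncation at $k=n$, that is, the same prior except that $f_k=0$ for all $k>n$. -/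

import Mathlib

open MeasureTheory ProbabilityTheory Filter Topology
open scoped ENNReal NNReal

noncomputable section

namespace HeavyTailedSeries

/-- The conditions on the density `h`: symmetric, positive, bounded, decreasing on `[0, ∞)`, with
`log (1 / h x) ≤ c₁ (1 + log^{1 + κ} (1 + x))` for `x ≥ 0`. -/
structure HeavyTailed (h : ℝ → ℝ) (c₁ κ : ℝ) : Prop where
  symm : ∀ x, h (-x) = h x
  pos : ∀ x, 0 < h x
  bounded : ∃ M, ∀ x, h x ≤ M
  decreasing : AntitoneOn h (Set.Ici 0)
  tail : ∀ x, 0 ≤ x → Real.log (1 / h x) ≤ c₁ * (1 + Real.log (1 + x) ^ (1 + κ))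

/-- The measure `H` on the real line has density `h`. -/
def HasDensity (H : Measure ℝ) (h : ℝ → ℝ) : Prop :=
  H = volume.withDensity (fun x => ENNReal.ofReal (h x))

/-- The scales `σ_k = exp (-(log k)²)`, `k ≥ 1`. -/
def scaleOT (k : ℕ+) : ℝ := Real.exp (-(Real.log (k : ℝ)) ^ 2)

/-- The scales `σ_k = k ^ (-1/2 - α)`, `k ≥ 1`. -/
def scaleHT (α : ℝ) (k : ℕ+) : ℝ := (k : ℝ) ^ (-(1 / 2) - α)

/-- Truncation of a scale sequence at `n`, so that `f_k = σ_k ζ_k = 0` for `k > n`. -/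
def truncate (n : ℕ) (σ : ℕ+ → ℝ) (k : ℕ+) : ℝ := if (k : ℕ) ≤ n then σ k else 0

/-- The series prior: the law of `(σ_k ζ_k)_{k ≥ 1}`, where the `ζ_k` are i.i.d. with law `H`. -/
def prior (H : Measure ℝ) (σ : ℕ+ → ℝ) : Measure (ℕ+ → ℝ) :=
  (Measure.infinitePi (fun _ : ℕ+ => H)).map (fun ζ k => σ k * ζ k)

instance (H : Measure ℝ) [IsProbabilityMeasure H] (σ : ℕ+ → ℝ) :
    IsProbabilityMeasure (prior H σ) :=
  Measure.isProbabilityMeasure_map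
    (measurable_pi_lambda _ fun k => (measurable_pi_apply k).const_mul (σ k)).aemeasurable

/-- The law `P_f` of the observations `X = (X_k)_{k ≥ 1}`: the `X_k` are independent with law
`N(f_k, 1/n)`. -/
def dataLaw (n : ℕ) (f : ℕ+ → ℝ) : Measure (ℕ+ → ℝ) :=
  Measure.infinitePi (fun k => gaussianReal (f k) (1 / (n : ℝ≥0)))

instance (n : ℕ) (f : ℕ+ → ℝ) : IsProbabilityMeasure (dataLaw n f) := by
  unfold dataLaw; infer_instance

theorem measurable_dataLaw (n : ℕ) : Measurable (dataLaw n) := by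
  refine Measurable.measure_of_isPiSystem_of_isProbabilityMeasure
    (S := squareCylinders fun _ : ℕ+ => {s : Set ℝ | MeasurableSet s})
    generateFrom_squareCylinders.symm
    (isPiSystem_squareCylinders (fun _ => MeasurableSpace.isPiSystem_measurableSet)
      fun _ => by simp) ?_
  rintro _ ⟨s, t, ht, rfl⟩
  have key : ∀ f, dataLaw n f ((s : Set ℕ+).pi t) =
      ∏ k ∈ s, gaussianReal (f k) (1 / (n : ℝ≥0)) (t k) :=
    fun f => Measure.infinitePi_pi _ (fun k _ => ht k trivial)
  simp_rw [key]
  refine Finset.measurable_prod _ fun k _ => ?_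
  have hk : Measurable fun m : ℝ => gaussianReal m (1 / (n : ℝ≥0)) := by
    have := measurable_gaussianReal
    fun_prop
  have htk : MeasurableSet (t k) := ht k trivial
  exact ((Measure.measurable_coe htk).comp hk).comp (measurable_pi_apply k)

/-- The sequence model as a Markov kernel from the parameter `f` to the observations. -/
def model (n : ℕ) : Kernel (ℕ+ → ℝ) (ℕ+ → ℝ) := ⟨dataLaw n, measurable_dataLaw n⟩

instance (n : ℕ) : IsMarkovKernel (model n) :=
  ⟨fun f => inferInstanceAs (IsProbabilityMeasure (dataLaw n f))⟩

/-- The posterior distribution: the conditional distribution of `f` given `X` when `f` has law `μ`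
and `X` given `f` has law `P_f`. -/
def posteriorLaw (n : ℕ) (μ : Measure (ℕ+ → ℝ)) [IsFiniteMeasure μ] :
    Kernel (ℕ+ → ℝ) (ℕ+ → ℝ) :=
  posterior (model n) μ

/-- The `ℓ²` norm, with values in `[0, ∞]`. -/
def l2norm (f : ℕ+ → ℝ) : ℝ≥0∞ := (∑' k, ENNReal.ofReal (f k ^ 2)) ^ (1 / 2 : ℝ)

/-- The Sobolev ball `{f : ∑ k^{2β} f_k² ≤ L²}`. -/
def sobolevBall (β L : ℝ) : Set (ℕ+ → ℝ) :=
  {f | Summable (fun k : ℕ+ => (k : ℝ) ^ (2 * β) * f k ^ 2) ∧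
    ∑' k : ℕ+, (k : ℝ) ^ (2 * β) * f k ^ 2 ≤ L ^ 2}

/-- `E_{f₀} μ_n[{f : ‖f - f₀‖₂ > (log n)^d n^{-β/(2β+1)}} | X^{(n)}] → 0` as `n → ∞`, for a sequence
of priors `μ_n`. -/
def ContractsAt (μ : ℕ → Measure (ℕ+ → ℝ)) [∀ n, IsFiniteMeasure (μ n)] (f₀ : ℕ+ → ℝ)
    (β d : ℝ) : Prop :=
  Tendsto (fun n : ℕ => ∫⁻ X, posteriorLaw n (μ n) X
      {f | ENNReal.ofReal (Real.log n ^ d * (n : ℝ) ^ (-β / (2 * β + 1))) < l2norm (f - f₀)}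
      ∂(dataLaw n f₀)) atTop (𝓝 0)

end HeavyTailedSeries

end

/-! By Markov's inequality it suffices to bound the `P_{f₀}`-expectation of the posterior mean of
`‖f - f₀‖₂²`. Prior and likelihood are products over coordinates, so this is a sum of
one-dimensional risks: `θ = σ_k ζ`, one observation `x ~ N(θ, 1/n)`, truth `a = f₀ k`. The sum is
cut at `K = n^{1/(2β+1)}`.

For `k ≤ K` (`coordRisk_le`), the posterior mean squared error is at most a multiple of `(x - a)²`
plus `1/n` times one plus the log of the inverse prior mass of the `n^{-1/2}`-ball around `a`. Heavy
tails make that log of order at most `log(1/σ_k)^{1+κ} + log n`, however far out `a / σ_k` lies. As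
`log(1/σ_k)` is at most of order `log² n`, these coordinates contribute at most `K/n =
n^{-2β/(2β+1)}` times a power of `log n`.

For `k > K` (`exists_coordRisk_le_of_small_scale`), `σ_k²` is at most of order `k^{-1-2β} ≤ 1/n`, so
the prior sits below the noise level and the risk is at most of order `σ_k² + a²`, with no
logarithm; these sum to order `K^{-2β}`, the same rate. For truth zero the bound follows from
Jensen's inequality for the evidence. A change of measure moves it to truth `a`; where the
likelihood ratio is large, the posterior second moment is bounded by that of a flat prior, `x² +
1/n`, since `h` is symmetric and unimodal.

The posterior is determined only up to null sets of the marginal law of the data, so `P_{f₀}` must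
be absolutely continuous with respect to that law. This holds because the prior charges `ℓ²` fully
and Gaussian shifts by `ℓ²` sequences preserve null sets.

Truncation at `n` only sets some scales with `k > n ≥ K` to zero, and the bound beyond the cutoff
allows scale zero. -/

namespace HeavyTailedSeries

/-! ### Absolute continuity of infinite product measures -/

section AbsolutelyContinuous

variable {ι : Type*} {X : ι → Type*} [∀ i, MeasurableSpace (X i)]

theorem lintegral_prod_infinitePi (μ : ∀ i, Measure (X i)) [∀ i, IsProbabilityMeasure (μ i)]
    (s : Finset ι) (g : ∀ i, X i → ℝ≥0∞) (hg : ∀ i, Measurable (g i)) :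
    ∫⁻ x, ∏ i ∈ s, g i (x i) ∂(Measure.infinitePi μ) = ∏ i ∈ s, ∫⁻ y, g i y ∂(μ i) := by
  refine (lintegral_prod_eq_prod_lintegral_of_indepFun s (fun i (x : ∀ i, X i) => g i (x i))
    (iIndepFun_infinitePi hg) (fun i => (hg i).comp (measurable_pi_apply i))).trans ?_
  refine Finset.prod_congr rfl fun i _ => ?_
  rw [← (measurePreserving_eval_infinitePi μ i).lintegral_comp (hg i)]

theorem pi_withDensity [Fintype ι] (ν : ∀ i, Measure (X i)) [∀ i, IsProbabilityMeasure (ν i)]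
    (r : ∀ i, X i → ℝ≥0∞) (hr : ∀ i, Measurable (r i))
    [∀ i, IsProbabilityMeasure ((ν i).withDensity (r i))] :
    Measure.pi (fun i => (ν i).withDensity (r i)) =
      (Measure.pi ν).withDensity (fun x => ∏ i, r i (x i)) := by
  refine Measure.pi_eq fun t ht => ?_
  rw [withDensity_apply _ (.univ_pi ht), ← lintegral_indicator (.univ_pi ht)]
  have : ((Set.univ.pi t).indicator fun x : ∀ i, X i => ∏ i, r i (x i)) =
      fun x => ∏ i, (t i).indicator (r i) (x i) := by
    ext x
    by_cases hx : x ∈ Set.univ.pi t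
    · rw [Set.indicator_of_mem hx]
      exact Finset.prod_congr rfl fun i _ => (Set.indicator_of_mem (hx i trivial) _).symm
    · rw [Set.indicator_of_notMem hx]
      obtain ⟨i, hi⟩ : ∃ i, x i ∉ t i := by simpa using hx
      exact (Finset.prod_eq_zero (Finset.mem_univ i) (Set.indicator_of_notMem hi _)).symm
  rw [this, ← Measure.infinitePi_eq_pi,
    lintegral_prod_infinitePi ν _ _ (fun i => (hr i).indicator (ht i))]
  refine Finset.prod_congr rfl fun i _ => ?_
  rw [lintegral_indicator (ht i), withDensity_apply _ (ht i)]

/-- A product measure is absolutely continuous with respect to another one if the densities of the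
factors have uniformly bounded products of second moments. -/
theorem infinitePi_absolutelyContinuous (μ ν : ∀ i, Measure (X i))
    [∀ i, IsProbabilityMeasure (μ i)] [∀ i, IsProbabilityMeasure (ν i)]
    (r : ∀ i, X i → ℝ≥0∞) (hr : ∀ i, Measurable (r i)) (hμ : ∀ i, μ i = (ν i).withDensity (r i))
    {C : ℝ≥0∞} (hC : C ≠ ∞) (hb : ∀ s : Finset ι, ∏ i ∈ s, ∫⁻ y, r i y ^ 2 ∂(ν i) ≤ C) :
    Measure.infinitePi μ ≪ Measure.infinitePi ν := by
  -- On a cylinder `μ` has a density `D` with respect to `ν`, and `D ≤ l + D² / l`. The second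
  -- moment of `D` is at most `C` whatever the finite set of coordinates.
  have hcyl : ∀ t ∈ measurableCylinders X, ∀ l : ℝ≥0, 0 < l →
      Measure.infinitePi μ t ≤ l * Measure.infinitePi ν t + C / l := by
    intro t ht l hl
    obtain ⟨s, S, hS, rfl⟩ := (mem_measurableCylinders t).1 ht
    rw [Measure.infinitePi_cylinder _ hS, Measure.infinitePi_cylinder _ hS]
    have : ∀ i : s, IsProbabilityMeasure ((ν i).withDensity (r i)) :=
      fun i => hμ i ▸ inferInstance
    have e : Measure.pi (fun i : s => μ i) =
        (Measure.pi fun i : s => ν i).withDensity (fun x => ∏ i : s, r i (x i)) := by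
      rw [← pi_withDensity (fun i : s => ν i) (fun i => r i) (fun i => hr i)]
      congr 1
      ext1 i
      exact hμ i
    have hl0 : (l : ℝ≥0∞) ≠ 0 := by simpa using hl.ne'
    rw [e, withDensity_apply _ hS]
    calc ∫⁻ x in S, ∏ i : s, r i (x i) ∂(Measure.pi fun i : s => ν i)
        ≤ ∫⁻ x in S, (l + (∏ i : s, r i (x i)) ^ 2 / l) ∂(Measure.pi fun i : s => ν i) := by
          refine lintegral_mono fun x => ?_
          set a := ∏ i : s, r i (x i)
          rcases le_total a l with h | h
          · exact h.trans le_self_add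
          · refine le_trans ?_ le_add_self
            rw [ENNReal.le_div_iff_mul_le (.inl hl0) (.inl ENNReal.coe_ne_top), sq]
            gcongr
      _ = l * (Measure.pi fun i : s => ν i) S
          + ∫⁻ x in S, (∏ i : s, r i (x i)) ^ 2 / l ∂(Measure.pi fun i : s => ν i) := by
          rw [lintegral_add_left measurable_const, setLIntegral_const]
      _ ≤ _ := by
          gcongr
          refine (setLIntegral_le_lintegral _ _).trans ?_
          simp_rw [div_eq_mul_inv]
          rw [lintegral_mul_const' _ _ (by simpa using hl.ne')]
          gcongr
          simp_rw [← Finset.prod_pow]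
          rw [← Measure.infinitePi_eq_pi,
            lintegral_prod_infinitePi (fun i : s => ν i) Finset.univ (fun i y => r i y ^ 2)
              (fun i => (hr i).pow_const 2)]
          simpa [Finset.prod_attach s (fun i => ∫⁻ y, r i y ^ 2 ∂(ν i))] using hb s
  refine Measure.AbsolutelyContinuous.mk fun A hA h0 => ?_
  -- Approximate the `ν`-null set `A` by a cylinder `t` in `μ + ν`-measure. Replacing `A` by `t`
  -- costs at most `l + 1` times the measure of the symmetric difference, hence the tolerance `ε /
  -- (l + 1)`.
  have key : ∀ l : ℝ≥0, 0 < l → Measure.infinitePi μ A ≤ C / l := by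
    intro l hl
    refine ENNReal.le_of_forall_pos_le_add fun ε hε _ => ?_
    have hε' : (0 : ℝ≥0∞) < (ε / (l + 1) : ℝ≥0) := by
      have : 0 < ε / (l + 1) := by positivity
      exact_mod_cast this
    obtain ⟨t, ht, hlt⟩ := exists_measure_symmDiff_lt_of_generateFrom_isSetRing
      (μ := Measure.infinitePi μ + Measure.infinitePi ν) isSetRing_measurableCylinders
      ⟨{Set.univ}, Set.countable_singleton _, by
        simpa using univ_mem_measurableCylinders X, by simp⟩
      generateFrom_measurableCylinders.symm hA hε'
    rw [Measure.add_apply] at hlt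
    have h1 : Measure.infinitePi ν t ≤ Measure.infinitePi ν (symmDiff t A) := by
      calc Measure.infinitePi ν t ≤ Measure.infinitePi ν (symmDiff t A ∪ A) := by
            refine measure_mono fun x hx => ?_
            by_cases hxA : x ∈ A
            · exact .inr hxA
            · exact .inl (.inl ⟨hx, hxA⟩)
        _ ≤ _ := (measure_union_le _ _).trans (by rw [h0, add_zero])
    have h2 : Measure.infinitePi μ A ≤
        Measure.infinitePi μ t + Measure.infinitePi μ (symmDiff t A) := by
      refine (measure_mono fun x hx => ?_).trans (measure_union_le _ _)
      by_cases hxt : x ∈ t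
      · exact .inl hxt
      · exact .inr (.inr ⟨hx, hxt⟩)
    calc Measure.infinitePi μ A ≤ _ := h2
      _ ≤ (l * Measure.infinitePi ν t + C / l) + Measure.infinitePi μ (symmDiff t A) := by
          gcongr
          exact hcyl t ht l hl
      _ ≤ C / l + ((l + 1) * (Measure.infinitePi μ (symmDiff t A)
            + Measure.infinitePi ν (symmDiff t A))) := by
          rw [add_comm _ (C / l : ℝ≥0∞), add_assoc]
          gcongr
          rw [add_mul, one_mul, mul_add]
          calc _ ≤ (l : ℝ≥0∞) * Measure.infinitePi ν (symmDiff t A)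
                + Measure.infinitePi μ (symmDiff t A) := by gcongr
            _ ≤ _ := by gcongr <;> simp
      _ ≤ C / l + ((l + 1) * (ε / (l + 1) : ℝ≥0)) := by gcongr
      _ = C / l + ε := by
          congr 1
          have : (l + 1) * (ε / (l + 1)) = ε := by field_simp
          exact_mod_cast this
  by_contra hne
  have hC0 : C ≠ 0 := by
    rintro rfl
    exact hne (by simpa using key 1 one_pos)
  have hlt : Measure.infinitePi μ A ≠ ∞ := measure_ne_top _ _
  set m := (Measure.infinitePi μ A).toNNReal with hm
  have hm' : (m : ℝ≥0∞) = Measure.infinitePi μ A := ENNReal.coe_toNNReal hlt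
  lift C to ℝ≥0 using hC
  have hmpos : 0 < m := ENNReal.toNNReal_pos hne hlt
  have hCpos : 0 < C := by simpa [pos_iff_ne_zero] using hC0
  -- For this `l` the bound `C / l` is half of `m`, the measure of `A`, which contradicts `m > 0`.
  have := key (2 * C / m) (by positivity)
  rw [← hm', ← ENNReal.coe_div (by positivity)] at this
  have h3 : m ≤ C / (2 * C / m) := by exact_mod_cast this
  have h4 : C / (2 * C / m) = m / 2 := by field_simp
  rw [h4] at h3
  exact absurd h3 (not_le.2 (NNReal.half_lt_self hmpos.ne'))

end AbsolutelyContinuous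

/-! ### Gaussian shifts and the marginal law of the data -/

section DataLaw

theorem gaussianPDFReal_mul_exp (a b : ℝ) {v : ℝ≥0} (hv : v ≠ 0) (x : ℝ) :
    gaussianPDFReal a v x * Real.exp ((b - a) * x / v - (b ^ 2 - a ^ 2) / (2 * v)) =
      gaussianPDFReal b v x := by
  have : (v : ℝ) ≠ 0 := by exact_mod_cast hv
  rw [gaussianPDFReal, gaussianPDFReal, mul_assoc, ← Real.exp_add]
  congr 2
  field_simp
  ring

theorem gaussianReal_eq_withDensity (a b : ℝ) {v : ℝ≥0} (hv : v ≠ 0) :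
    gaussianReal b v = (gaussianReal a v).withDensity
      (fun x => ENNReal.ofReal
        (Real.exp ((b - a) * x / v - (b ^ 2 - a ^ 2) / (2 * v)))) := by
  rw [gaussianReal_of_var_ne_zero _ hv, gaussianReal_of_var_ne_zero _ hv,
    ← withDensity_mul _ (by fun_prop) (by fun_prop)]
  congr 1
  ext x
  rw [Pi.mul_apply, gaussianPDF, gaussianPDF, ← ENNReal.ofReal_mul (gaussianPDFReal_nonneg _ _ _),
    gaussianPDFReal_mul_exp a b hv]

theorem lintegral_gaussianReal_density_sq (a b : ℝ) {v : ℝ≥0} (hv : v ≠ 0) :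
    ∫⁻ x, ENNReal.ofReal (Real.exp ((b - a) * x / v - (b ^ 2 - a ^ 2) / (2 * v))) ^ 2
      ∂(gaussianReal a v) = ENNReal.ofReal (Real.exp ((b - a) ^ 2 / v)) := by
  have hv' : (v : ℝ) ≠ 0 := by exact_mod_cast hv
  -- Completing the square: the squared likelihood ratio is a constant times the likelihood ratio of
  -- `N(2b - a, v)`, which integrates to one.
  have e : ∀ x, ENNReal.ofReal
      (Real.exp ((b - a) * x / v - (b ^ 2 - a ^ 2) / (2 * v))) ^ 2 =
      ENNReal.ofReal (Real.exp ((b - a) ^ 2 / v)) * ENNReal.ofReal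
        (Real.exp (((2 * b - a) - a) * x / v - ((2 * b - a) ^ 2 - a ^ 2) / (2 * v))) := by
    intro x
    rw [← ENNReal.ofReal_pow (Real.exp_nonneg _), ← ENNReal.ofReal_mul (Real.exp_nonneg _),
      ← Real.exp_add, ← Real.exp_nat_mul]
    congr 2
    field_simp
    ring
  simp_rw [e]
  rw [lintegral_const_mul _ (by fun_prop)]
  have := (gaussianReal_eq_withDensity a (2 * b - a) hv) ▸
    measure_univ (μ := gaussianReal (2 * b - a) v)
  rw [withDensity_apply _ .univ, Measure.restrict_univ] at this
  rw [this, mul_one]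

/-- The second moments of the coordinate likelihood ratios are `exp (n (g k - f k)²)`, so their
finite products are bounded by the exponential of `n` times the squared `ℓ²` distance. -/
theorem dataLaw_absolutelyContinuous {n : ℕ} (hn : n ≠ 0) {f g : ℕ+ → ℝ}
    (hfg : Summable fun k => (g k - f k) ^ 2) : dataLaw n g ≪ dataLaw n f := by
  have hv : (1 / (n : ℝ≥0)) ≠ 0 := by simpa using hn
  refine infinitePi_absolutelyContinuous _ _ _ (fun i => ?_)
    (fun k => gaussianReal_eq_withDensity (f k) (g k) hv)
    (C := ENNReal.ofReal (Real.exp ((∑' k, (g k - f k) ^ 2) / (1 / (n : ℝ≥0) : ℝ≥0))))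
    ENNReal.ofReal_ne_top fun s => ?_
  · fun_prop
  · simp_rw [lintegral_gaussianReal_density_sq _ _ hv]
    rw [← ENNReal.ofReal_prod_of_nonneg fun _ _ => Real.exp_nonneg _, ← Real.exp_sum,
      ← Finset.sum_div]
    gcongr
    exact hfg.sum_le_tsum _ fun _ _ => sq_nonneg _

theorem ae_summable_sq_prior (H : Measure ℝ) [IsProbabilityMeasure H] {σ : ℕ+ → ℝ}
    (hσ : Summable fun k => σ k ^ 2) (hH : ∫⁻ x, ENNReal.ofReal (x ^ 2) ∂H ≠ ∞) :
    ∀ᵐ f ∂(prior H σ), Summable fun k => f k ^ 2 := by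
  have hm : Measurable fun (ζ : ℕ+ → ℝ) k => σ k * ζ k :=
    measurable_pi_lambda _ fun k => by fun_prop
  have hint : ∫⁻ f, ∑' k, ENNReal.ofReal (f k ^ 2) ∂(prior H σ) ≠ ∞ := by
    rw [prior, lintegral_map (by fun_prop) hm, lintegral_tsum fun k => (by fun_prop :
      Measurable fun ζ : ℕ+ → ℝ => ENNReal.ofReal ((σ k * ζ k) ^ 2)).aemeasurable]
    have : ∀ k, ∫⁻ ζ : ℕ+ → ℝ, ENNReal.ofReal ((σ k * ζ k) ^ 2)
        ∂(Measure.infinitePi fun _ : ℕ+ => H) =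
        ENNReal.ofReal (σ k ^ 2) * ∫⁻ x, ENNReal.ofReal (x ^ 2) ∂H := by
      intro k
      rw [← lintegral_const_mul _ (by fun_prop),
        ← (measurePreserving_eval_infinitePi (fun _ : ℕ+ => H) k).lintegral_comp (by fun_prop)]
      refine lintegral_congr fun ζ => ?_
      rw [mul_pow, ENNReal.ofReal_mul (sq_nonneg _)]
    simp_rw [this]
    rw [ENNReal.tsum_mul_right]
    exact ENNReal.mul_ne_top hσ.tsum_ofReal_ne_top hH
  filter_upwards [ae_lt_top (by fun_prop) hint] with f hf
  have := ENNReal.summable_toReal hf.ne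
  simpa [ENNReal.toReal_ofReal, sq_nonneg] using this

/-- The law of the data under a square summable parameter is absolutely continuous with respect to
the marginal law of the data. -/
theorem dataLaw_absolutelyContinuous_comp_prior {n : ℕ} (hn : n ≠ 0) (H : Measure ℝ)
    [IsProbabilityMeasure H] {σ : ℕ+ → ℝ} (hσ : Summable fun k => σ k ^ 2)
    (hH : ∫⁻ x, ENNReal.ofReal (x ^ 2) ∂H ≠ ∞) {f₀ : ℕ+ → ℝ}
    (hf₀ : Summable fun k => f₀ k ^ 2) : dataLaw n f₀ ≪ model n ∘ₘ prior H σ := by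
  refine Measure.AbsolutelyContinuous.mk fun A hA h0 => ?_
  rw [Measure.bind_apply hA (model n).aemeasurable, lintegral_eq_zero_iff
    ((model n).measurable_coe hA)] at h0
  -- A null set of the mixture is null under `P_f` for almost every `f`; a single such `f` in `ℓ²`
  -- is enough.
  obtain ⟨f, hf, hfA⟩ := ((ae_summable_sq_prior H hσ hH).and h0).exists
  refine dataLaw_absolutelyContinuous hn ?_ hfA
  refine Summable.of_nonneg_of_le (fun _ => sq_nonneg _) (fun k => ?_)
    ((hf₀.mul_left 2).add (hf.mul_left 2))
  nlinarith [sq_nonneg (f₀ k + f k)]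

end DataLaw

/-! ### Bayes' formula for a single Gaussian observation -/

section CoordinatePosterior

/-- The marginal density of an observation `x ~ N(θ, v)` when `θ` has law `π`. -/
noncomputable def evidence (v : ℝ≥0) (π : Measure ℝ) (x : ℝ) : ℝ≥0∞ := ∫⁻ θ, gaussianPDF θ v x ∂π

theorem measurable_gaussianPDF_mean (v : ℝ≥0) :
    Measurable fun p : ℝ × ℝ => gaussianPDF p.1 v p.2 := by
  have h : Measurable fun p : ℝ × ℝ => (p.1, v, p.2) := by fun_prop
  exact measurable_uncurry_gaussianPDF.comp h

@[fun_prop]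
theorem measurable_gaussianPDF_mean' (v : ℝ≥0) (x : ℝ) :
    Measurable fun θ : ℝ => gaussianPDF θ v x := by
  have h : Measurable fun θ : ℝ => (θ, v, x) := by fun_prop
  exact measurable_uncurry_gaussianPDF.comp h

theorem measurable_evidence (v : ℝ≥0) (π : Measure ℝ) [SFinite π] :
    Measurable (evidence v π) :=
  Measurable.lintegral_prod_left' (measurable_gaussianPDF_mean v)

theorem evidence_ne_zero {v : ℝ≥0} (hv : v ≠ 0) (π : Measure ℝ) [IsProbabilityMeasure π] (x : ℝ) :
    evidence v π x ≠ 0 := by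
  rw [evidence, Ne, lintegral_eq_zero_iff (by fun_prop)]
  intro h
  obtain ⟨θ, hθ⟩ := h.exists
  exact (gaussianPDF_pos θ hv x).ne' hθ

theorem evidence_ne_top (v : ℝ≥0) (π : Measure ℝ) [IsProbabilityMeasure π] (x : ℝ) :
    evidence v π x ≠ ∞ := by
  refine ne_top_of_le_ne_top
    (ENNReal.ofReal_ne_top (r := (√(2 * Real.pi * v))⁻¹)) ?_
  calc evidence v π x ≤ ∫⁻ _, ENNReal.ofReal (√(2 * Real.pi * v))⁻¹ ∂π := by
        refine lintegral_mono fun θ => ENNReal.ofReal_le_ofReal ?_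
        rw [gaussianPDFReal]
        refine mul_le_of_le_one_right (by positivity) (Real.exp_le_one_iff.2 ?_)
        exact div_nonpos_of_nonpos_of_nonneg (by nlinarith [sq_nonneg (x - θ)]) (by positivity)
    _ = _ := by simp

/-- The posterior distribution of `θ ~ π` given an observation `x ~ N(θ, v)`. -/
noncomputable def coordPosterior (v : ℝ≥0) (π : Measure ℝ) [SFinite π] : Kernel ℝ ℝ :=
  Kernel.withDensity (Kernel.const ℝ π) (fun x θ => gaussianPDF θ v x / evidence v π x)

theorem measurable_coordPosterior_density (v : ℝ≥0) (π : Measure ℝ) [SFinite π] :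
    Measurable (Function.uncurry fun x θ => gaussianPDF θ v x / evidence v π x) :=
  ((measurable_gaussianPDF_mean v).comp measurable_swap).div
    ((measurable_evidence v π).comp measurable_fst)

theorem lintegral_coordPosterior (v : ℝ≥0) (π : Measure ℝ) [SFinite π] {g : ℝ → ℝ≥0∞}
    (hg : Measurable g) (x : ℝ) :
    ∫⁻ θ, g θ ∂(coordPosterior v π x) =
      (∫⁻ θ, g θ * gaussianPDF θ v x ∂π) / evidence v π x := by
  rw [coordPosterior, Kernel.lintegral_withDensity _ (measurable_coordPosterior_density v π) _ hg,
    Kernel.const_apply, div_eq_mul_inv, ← lintegral_mul_const _ (by fun_prop)]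
  refine lintegral_congr fun θ => ?_
  rw [div_eq_mul_inv]
  ring

theorem isMarkovKernel_coordPosterior {v : ℝ≥0} (hv : v ≠ 0) (π : Measure ℝ)
    [IsProbabilityMeasure π] : IsMarkovKernel (coordPosterior v π) := by
  refine ⟨fun x => ⟨?_⟩⟩
  have := lintegral_coordPosterior v π (g := fun _ => 1) measurable_const x
  simp only [lintegral_const, one_mul] at this
  rw [this]
  exact ENNReal.div_self (evidence_ne_zero hv π x) (evidence_ne_top v π x)

theorem lintegral_evidence_mul {v : ℝ≥0} (hv : v ≠ 0) (π : Measure ℝ) [SFinite π]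
    {g : ℝ → ℝ≥0∞} (hg : Measurable g) :
    ∫⁻ θ, ∫⁻ x, g x ∂(gaussianReal θ v) ∂π = ∫⁻ x, evidence v π x * g x := by
  have : ∀ θ, ∫⁻ x, g x ∂(gaussianReal θ v) = ∫⁻ x, gaussianPDF θ v x * g x := by
    intro θ
    rw [gaussianReal_of_var_ne_zero _ hv, lintegral_withDensity_eq_lintegral_mul _
      (measurable_gaussianPDF θ v) hg]
    rfl
  simp_rw [this]
  rw [lintegral_lintegral_swap]
  · refine lintegral_congr fun x => ?_
    rw [lintegral_mul_const _ (by fun_prop), evidence]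
  · exact ((measurable_gaussianPDF_mean v).mul (hg.comp measurable_snd)).aemeasurable

/-- Bayes' formula for one coordinate. -/
theorem setLIntegral_coordPosterior {v : ℝ≥0} (hv : v ≠ 0) (π : Measure ℝ)
    [IsProbabilityMeasure π] {A B : Set ℝ} (hA : MeasurableSet A) (hB : MeasurableSet B) :
    ∫⁻ θ, ∫⁻ x, A.indicator (fun x => coordPosterior v π x B) x ∂(gaussianReal θ v) ∂π =
      ∫⁻ θ, B.indicator (fun θ => gaussianReal θ v A) θ ∂π := by
  rw [lintegral_evidence_mul hv π ((Kernel.measurable_coe _ hB).indicator hA)]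
  have h1 : ∀ x, evidence v π x * A.indicator (fun x => coordPosterior v π x B) x =
      ∫⁻ θ, A.indicator 1 x * (B.indicator 1 θ * gaussianPDF θ v x) ∂π := by
    intro x
    by_cases hx : x ∈ A
    · rw [Set.indicator_of_mem hx, ← lintegral_indicator_one hB,
        lintegral_coordPosterior v π (measurable_one.indicator hB),
        ENNReal.mul_div_cancel (evidence_ne_zero hv π x) (evidence_ne_top v π x)]
      simp [hx]
    · simp [hx]
  simp_rw [h1]
  rw [lintegral_lintegral_swap]
  · refine lintegral_congr fun θ => ?_
    by_cases hθ : θ ∈ B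
    · rw [Set.indicator_of_mem (s := B) hθ (fun θ => gaussianReal θ v A),
        gaussianReal_apply _ hv, ← lintegral_indicator hA]
      refine lintegral_congr fun x => ?_
      by_cases hx : x ∈ A <;> simp [hx, hθ]
    · simp [hθ]
  · exact ((measurable_one.indicator hA).comp measurable_fst).mul
      (((measurable_one.indicator hB).comp measurable_snd).mul
        ((measurable_gaussianPDF_mean v).comp measurable_swap)) |>.aemeasurable

end CoordinatePosterior

/-! ### Factorisation of the posterior over coordinates -/

section ProductPosterior

/-- The law of `s * z` for `z` with law `H`: a coordinate of the series prior with scale `s`. -/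
noncomputable def coordPrior (H : Measure ℝ) (s : ℝ) : Measure ℝ := H.map (fun z => s * z)

instance (H : Measure ℝ) [IsProbabilityMeasure H] (s : ℝ) : IsProbabilityMeasure (coordPrior H s) :=
  Measure.isProbabilityMeasure_map (by fun_prop)

theorem prior_eq_infinitePi (H : Measure ℝ) [IsProbabilityMeasure H] (σ : ℕ+ → ℝ) :
    prior H σ = Measure.infinitePi (fun k => coordPrior H (σ k)) :=
  Measure.infinitePi_map_pi (fun _ : ℕ+ => H) (f := fun k z => σ k * z) (fun k => by fun_prop)

theorem lintegral_prod_dataLaw (n : ℕ) (f : ℕ+ → ℝ) (s : Finset ℕ+) (g : ℕ+ → ℝ → ℝ≥0∞)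
    (hg : ∀ k, Measurable (g k)) :
    ∫⁻ x, ∏ k ∈ s, g k (x k) ∂(dataLaw n f) =
      ∏ k ∈ s, ∫⁻ y, g k y ∂(gaussianReal (f k) (1 / (n : ℝ≥0))) :=
  lintegral_prod_infinitePi _ s g hg

theorem measurable_lintegral_gaussianReal (v : ℝ≥0) {g : ℝ → ℝ≥0∞} (hg : Measurable g) :
    Measurable fun θ => ∫⁻ y, g y ∂(gaussianReal θ v) := by
  have hk : Measurable fun m : ℝ => gaussianReal m v := by
    have := measurable_gaussianReal
    fun_prop
  exact (Measure.measurable_lintegral hg).comp hk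

/-- Independence across coordinates makes the other observations irrelevant for `f k`. A kernel is
determined almost everywhere by its joint law with the data, so it suffices to compare masses of
boxes. Both masses are finite products of one-dimensional integrals, whose factors agree directly
for `i ≠ k` and by `setLIntegral_coordPosterior` for `i = k`. -/
theorem map_posteriorLaw_eval {n : ℕ} (hn : n ≠ 0) (H : Measure ℝ) [IsProbabilityMeasure H]
    (σ : ℕ+ → ℝ) (k : ℕ+) :
    ∀ᵐ X ∂(model n ∘ₘ prior H σ), (posteriorLaw n (prior H σ) X).map (fun f => f k) =
      coordPosterior (1 / (n : ℝ≥0)) (coordPrior H (σ k)) (X k) := by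
  have hv : (1 / (n : ℝ≥0)) ≠ 0 := by simpa using hn
  set v : ℝ≥0 := 1 / (n : ℝ≥0) with hvdef
  have hMk := isMarkovKernel_coordPosterior hv (coordPrior H (σ k))
  have hek : Measurable fun f : ℕ+ → ℝ => f k := measurable_pi_apply k
  have hMP : IsMarkovKernel (posteriorLaw n (prior H σ)) := by
    unfold posteriorLaw; infer_instance
  have hMP' : IsMarkovKernel ((posteriorLaw n (prior H σ)).map (fun f : ℕ+ → ℝ => f k)) :=
    Kernel.IsMarkovKernel.map _ hek
  set M := model n ∘ₘ prior H σ with hM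
  suffices h : ((posteriorLaw n (prior H σ)).map (fun f : ℕ+ → ℝ => f k)) =ᵐ[M]
      (coordPosterior v (coordPrior H (σ k))).comap (fun X : ℕ+ → ℝ => X k) hek by
    filter_upwards [h] with X hX
    rw [Kernel.map_apply _ hek, Kernel.comap_apply] at hX
    exact hX
  refine Kernel.ae_eq_of_compProd_eq (Measure.ext_prod fun {A B} hA hB => ?_)
  rw [Measure.compProd_apply_prod hA hB, Measure.compProd_apply_prod hA hB]
  simp_rw [Kernel.map_apply' _ hek _ hB, Kernel.comap_apply]
  have hqB : Measurable fun x => coordPosterior v (coordPrior H (σ k)) x B :=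
    Kernel.measurable_coe _ hB
  rw [← withDensity_apply _ hA, ← withDensity_apply _ hA]
  have hfin : IsFiniteMeasure (M.withDensity
      fun X => posteriorLaw n (prior H σ) X ((fun f : ℕ+ → ℝ => f k) ⁻¹' B)) := by
    refine isFiniteMeasure_withDensity (ne_top_of_le_ne_top ENNReal.one_ne_top ?_)
    calc _ ≤ ∫⁻ _, 1 ∂M := lintegral_mono fun X => prob_le_one
      _ = 1 := by simp
  have hbox : ∀ (s : Finset ℕ+) (t : ℕ+ → Set ℝ), k ∈ s → (∀ i, MeasurableSet (t i)) →
      M.withDensity (fun X => posteriorLaw n (prior H σ) X ((fun f : ℕ+ → ℝ => f k) ⁻¹' B))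
        ((s : Set ℕ+).pi t) =
      M.withDensity (fun X => coordPosterior v (coordPrior H (σ k)) (X k) B)
        ((s : Set ℕ+).pi t) := by
    intro s t hks ht
    have hst : MeasurableSet ((s : Set ℕ+).pi t) := .pi s.countable_toSet fun i _ => ht i
    rw [withDensity_apply _ hst, withDensity_apply _ hst]
    -- The defining property of the posterior reverses the order of sampling: `f` is drawn from the
    -- prior first, then the data given `f`.
    have hL : ∫⁻ X in (s : Set ℕ+).pi t,
        posteriorLaw n (prior H σ) X ((fun f : ℕ+ → ℝ => f k) ⁻¹' B) ∂M =
        ∏ i ∈ s, ∫⁻ θ, (if i = k then B.indicator 1 θ else 1) * gaussianReal θ v (t i)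
          ∂(coordPrior H (σ i)) := by
      rw [← Measure.compProd_apply_prod hst (hek hB), posteriorLaw,
        compProd_posterior_eq_map_swap, Measure.map_apply measurable_swap (hst.prod (hek hB)),
        Set.preimage_swap_prod, Measure.compProd_apply_prod (hek hB) hst,
        ← lintegral_indicator (hek hB), prior_eq_infinitePi,
        ← lintegral_prod_infinitePi (fun i => coordPrior H (σ i)) s
          (fun i θ => (if i = k then B.indicator 1 θ else 1) * gaussianReal θ v (t i))]
      · refine lintegral_congr fun f => ?_
        rw [Finset.prod_mul_distrib, Finset.prod_ite_eq' s k, if_pos hks]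
        have : model n f ((s : Set ℕ+).pi t) = ∏ i ∈ s, gaussianReal (f i) v (t i) :=
          Measure.infinitePi_pi _ (fun i _ => ht i)
        by_cases hf : f k ∈ B
        · simp [hf, this]
        · simp [hf]
      · intro i
        refine Measurable.mul ?_ ?_
        · split_ifs
          · exact measurable_one.indicator hB
          · exact measurable_const
        · simpa only [lintegral_indicator_one (ht i)] using
            measurable_lintegral_gaussianReal v (measurable_one.indicator (ht i))
    have hR : ∫⁻ X in (s : Set ℕ+).pi t,
        coordPosterior v (coordPrior H (σ k)) (X k) B ∂M =
        ∏ i ∈ s, ∫⁻ θ, ∫⁻ x, (if i = k then coordPosterior v (coordPrior H (σ k)) x B else 1) *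
          (t i).indicator 1 x ∂(gaussianReal θ v) ∂(coordPrior H (σ i)) := by
      have hmeas : ∀ i, Measurable fun x =>
          (if i = k then coordPosterior v (coordPrior H (σ k)) x B else 1) *
          (t i).indicator (1 : ℝ → ℝ≥0∞) x := by
        intro i
        refine Measurable.mul ?_ (measurable_one.indicator (ht i))
        split_ifs
        · exact hqB
        · exact measurable_const
      rw [← lintegral_indicator hst, hM, Measure.lintegral_bind (model n).aemeasurable
        (f := ((s : Set ℕ+).pi t).indicator
          fun X => coordPosterior v (coordPrior H (σ k)) (X k) B)
        ((hqB.comp hek).indicator hst).aemeasurable, prior_eq_infinitePi,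
        ← lintegral_prod_infinitePi (fun i => coordPrior H (σ i)) s
          (fun i θ => ∫⁻ x, (if i = k then coordPosterior v (coordPrior H (σ k)) x B else 1) *
          (t i).indicator 1 x ∂(gaussianReal θ v))
          (fun i => measurable_lintegral_gaussianReal v (hmeas i))]
      refine lintegral_congr fun f => ?_
      rw [← lintegral_prod_dataLaw n f s _ hmeas]
      refine lintegral_congr fun X => ?_
      rw [Finset.prod_mul_distrib, Finset.prod_ite_eq' s k, if_pos hks]
      by_cases hX : X ∈ (s : Set ℕ+).pi t
      · rw [Set.indicator_of_mem hX, Finset.prod_eq_one fun i hi => ?_, mul_one]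
        simp [hX i hi]
      · rw [Set.indicator_of_notMem hX]
        obtain ⟨i, hi, hit⟩ : ∃ i ∈ s, X i ∉ t i := by simpa [Set.mem_pi] using hX
        rw [Finset.prod_eq_zero hi (by simp [hit]), mul_zero]
    rw [hL, hR]
    refine Finset.prod_congr rfl fun i _ => ?_
    rcases eq_or_ne i k with rfl | hik
    · simp only [if_true]
      have := setLIntegral_coordPosterior hv (coordPrior H (σ i)) (ht i) hB
      convert this.symm using 1
      · refine lintegral_congr fun θ => ?_
        by_cases hθ : θ ∈ B <;> simp [hθ]
      · refine lintegral_congr fun θ => lintegral_congr fun x => ?_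
        by_cases hx : x ∈ t i <;> simp [hx]
    · simp [hik, ht i]
  have hext : M.withDensity
        (fun X => posteriorLaw n (prior H σ) X ((fun f : ℕ+ → ℝ => f k) ⁻¹' B)) =
      M.withDensity (fun X => coordPosterior v (coordPrior H (σ k)) (X k) B) := by
    refine ext_of_generate_finite
      (squareCylinders fun _ : ℕ+ => {s : Set ℝ | MeasurableSet s})
      generateFrom_squareCylinders.symm
      (isPiSystem_squareCylinders (fun _ => MeasurableSpace.isPiSystem_measurableSet)
        fun _ => by simp) ?_ ?_
    · rintro _ ⟨s, t, ht, rfl⟩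
      -- A box that does not constrain coordinate `k` is padded there by `univ`, as `hbox` needs `k`
      -- among its coordinates.
      have e : (s : Set ℕ+).pi t =
          ((insert k s : Finset ℕ+) : Set ℕ+).pi fun i => if i ∈ s then t i else Set.univ := by
        ext X
        simp only [Set.mem_pi, Finset.mem_coe, Finset.mem_insert]
        constructor
        · intro h i _
          split_ifs with his
          · exact h i his
          · trivial
        · intro h i hi
          simpa [hi] using h i (.inr hi)
      rw [e]
      refine hbox _ _ (Finset.mem_insert_self _ _) fun i => ?_
      split_ifs
      · exact ht i trivial
      · exact .univ
    · simpa using hbox {k} (fun _ => Set.univ) (Finset.mem_singleton_self k) fun _ => .univ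
  rw [hext]

/-- The posterior risk of a coordinate. -/
theorem lintegral_posteriorLaw_eval {n : ℕ} (hn : n ≠ 0) (H : Measure ℝ) [IsProbabilityMeasure H]
    {σ : ℕ+ → ℝ} (hσ : Summable fun k => σ k ^ 2) (hH : ∫⁻ x, ENNReal.ofReal (x ^ 2) ∂H ≠ ∞)
    {f₀ : ℕ+ → ℝ} (hf₀ : Summable fun k => f₀ k ^ 2) (k : ℕ+) {g : ℝ → ℝ≥0∞} (hg : Measurable g) :
    ∫⁻ X, ∫⁻ f, g (f k) ∂(posteriorLaw n (prior H σ) X) ∂(dataLaw n f₀) =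
      ∫⁻ x, ∫⁻ θ, g θ ∂(coordPosterior (1 / (n : ℝ≥0)) (coordPrior H (σ k)) x)
        ∂(gaussianReal (f₀ k) (1 / (n : ℝ≥0))) := by
  -- The coordinate formula holds almost surely under the marginal law; absolute continuity
  -- transfers it to the data law at `f₀`.
  have h := (dataLaw_absolutelyContinuous_comp_prior hn H hσ hH hf₀).ae_le
    (map_posteriorLaw_eval hn H σ k)
  have e := (measurePreserving_eval_infinitePi
    (fun k => gaussianReal (f₀ k) (1 / (n : ℝ≥0))) k).lintegral_comp
    (Measurable.lintegral_kernel hg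
      (κ := coordPosterior (1 / (n : ℝ≥0)) (coordPrior H (σ k))))
  refine Eq.trans ?_ e
  refine lintegral_congr_ae ?_
  filter_upwards [h] with X hX
  rw [← lintegral_map hg (measurable_pi_apply k)]
  exact congrArg (fun m => ∫⁻ θ, g θ ∂m) hX

end ProductPosterior

/-! ### Posterior moments and evidence bounds in dimension one -/

section Univariate

theorem lintegral_coordPosterior_le {v : ℝ≥0} (π : Measure ℝ) [SFinite π]
    {g : ℝ → ℝ≥0∞} (hg : Measurable g) (x : ℝ) {G : ℝ≥0∞}
    (h : ∫⁻ θ, g θ * gaussianPDF θ v x ∂π ≤ G * evidence v π x) :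
    ∫⁻ θ, g θ ∂(coordPosterior v π x) ≤ G := by
  rw [lintegral_coordPosterior v π hg]
  exact ENNReal.div_le_of_le_mul h

/-- The posterior mean squared error is controlled by the prior mass of a neighbourhood of `a`. -/
theorem lintegral_sq_sub_coordPosterior_le {v : ℝ≥0} (hv : v ≠ 0) (π : Measure ℝ)
    [IsProbabilityMeasure π] (a x : ℝ) {p : ℝ} (hp : 0 < p)
    (hpπ : ENNReal.ofReal p ≤ π {θ | (θ - a) ^ 2 ≤ v}) :
    ∫⁻ θ, ENNReal.ofReal ((θ - a) ^ 2) ∂(coordPosterior v π x) ≤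
      ENNReal.ofReal (4 * (2 * (x - a) ^ 2 + v * (2 + Real.log (1 / p)))) := by
  have hv0 : (0 : ℝ) < v := by exact_mod_cast pos_iff_ne_zero.2 hv
  have hp1 : p ≤ 1 := by
    have := hpπ.trans prob_le_one
    simpa using this
  have hlogp : 0 ≤ Real.log (1 / p) := Real.log_nonneg (by rw [le_div_iff₀ hp]; linarith)
  refine lintegral_coordPosterior_le π (by fun_prop) x ?_
  set N := (√(2 * Real.pi * v))⁻¹ with hN
  have hN0 : 0 < N := by positivity
  set q := (x - a) ^ 2 / v with hq
  have hq0 : 0 ≤ q := by positivity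
  have hqv : v * q = (x - a) ^ 2 := by rw [hq]; field_simp
  have hev : ENNReal.ofReal (p * (N * Real.exp (-q - 1))) ≤ evidence v π x := by
    calc ENNReal.ofReal (p * (N * Real.exp (-q - 1)))
        = ENNReal.ofReal (N * Real.exp (-q - 1)) * ENNReal.ofReal p := by
          rw [mul_comm, ENNReal.ofReal_mul (by positivity)]
      _ ≤ ENNReal.ofReal (N * Real.exp (-q - 1)) * π {θ | (θ - a) ^ 2 ≤ v} := by gcongr
      _ = ∫⁻ θ in {θ | (θ - a) ^ 2 ≤ v}, ENNReal.ofReal (N * Real.exp (-q - 1)) ∂π := by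
          rw [setLIntegral_const]
      _ ≤ ∫⁻ θ in {θ | (θ - a) ^ 2 ≤ v}, gaussianPDF θ v x ∂π := by
          refine setLIntegral_mono (by fun_prop) fun θ hθ => ENNReal.ofReal_le_ofReal ?_
          rw [gaussianPDFReal]
          gcongr
          rw [le_div_iff₀ (by positivity)]
          have : (θ - a) ^ 2 ≤ v := hθ
          nlinarith [sq_nonneg ((x - a) + (θ - a))]
      _ ≤ _ := setLIntegral_le_lintegral _ _
  have hpt : ∀ θ, ENNReal.ofReal ((θ - a) ^ 2) * gaussianPDF θ v x ≤
      ENNReal.ofReal (4 * v * (2 * q + 1 + Real.log (1 / p))) * gaussianPDF θ v x +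
        ENNReal.ofReal (4 * v) * ENNReal.ofReal (p * (N * Real.exp (-q - 1))) := by
    intro θ
    rw [gaussianPDF, ← ENNReal.ofReal_mul (sq_nonneg _), ← ENNReal.ofReal_mul (by positivity),
      ← ENNReal.ofReal_mul (by positivity), ← ENNReal.ofReal_add
        (mul_nonneg (by positivity) (gaussianPDFReal_nonneg _ _ _)) (by positivity)]
    refine ENNReal.ofReal_le_ofReal ?_
    set w := (θ - a) ^ 2 / v with hw
    have hwv : v * w = (θ - a) ^ 2 := by rw [hw]; field_simp
    -- From `w / 4 ≤ l + exp (w / 4 - l)`: the level `l` is chosen so that the exponential times the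
    -- Gaussian density is at most the lower bound `hev` for the evidence. The factor `1 / 4` lets
    -- `(θ - a)² ≤ 2 (x - θ)² + 2 (x - a)²` absorb the growth in `θ`.
    set l := 2 * q + 1 + Real.log (1 / p) with hl
    have h1 : w / 4 ≤ l + Real.exp (w / 4 - l) := by
      linarith [Real.add_one_le_exp (w / 4 - l)]
    have h2 : Real.exp (w / 4 - l) * gaussianPDFReal θ v x ≤ p * (N * Real.exp (-q - 1)) := by
      have e : Real.exp (w / 4 - l) = p * Real.exp (w / 4 - 2 * q - 1) := by
        rw [hl, Real.log_div one_ne_zero hp.ne', Real.log_one]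
        rw [show w / 4 - (2 * q + 1 + (0 - Real.log p)) =
          Real.log p + (w / 4 - 2 * q - 1) by ring, Real.exp_add, Real.exp_log hp]
      rw [e, gaussianPDFReal, ← hN, mul_assoc]
      refine mul_le_mul_of_nonneg_left ?_ hp.le
      rw [mul_left_comm, ← Real.exp_add]
      refine mul_le_mul_of_nonneg_left (Real.exp_le_exp.2 ?_) hN0.le
      rw [← sub_nonneg]
      have : -q - 1 - (w / 4 - 2 * q - 1 + -(x - θ) ^ 2 / (2 * v)) =
          ((x - θ) ^ 2 / 2 + (x - a) ^ 2 - (θ - a) ^ 2 / 4) / v := by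
        rw [hq, hw]; field_simp; ring
      rw [this]
      refine div_nonneg ?_ hv0.le
      nlinarith [sq_nonneg ((x - a) * 3 - (θ - a)), sq_nonneg (2 * (x - a) - (θ - a)),
        sq_nonneg (x - a)]
    calc (θ - a) ^ 2 * gaussianPDFReal θ v x
        = 4 * v * (w / 4 * gaussianPDFReal θ v x) := by rw [← hwv]; ring
      _ ≤ 4 * v * ((l + Real.exp (w / 4 - l)) * gaussianPDFReal θ v x) := by
          have := gaussianPDFReal_nonneg θ v x
          gcongr
      _ = 4 * v * l * gaussianPDFReal θ v x +
          4 * v * (Real.exp (w / 4 - l) * gaussianPDFReal θ v x) := by ring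
      _ ≤ _ := by gcongr
  calc ∫⁻ θ, ENNReal.ofReal ((θ - a) ^ 2) * gaussianPDF θ v x ∂π
      ≤ ∫⁻ θ, (ENNReal.ofReal (4 * v * (2 * q + 1 + Real.log (1 / p))) * gaussianPDF θ v x +
        ENNReal.ofReal (4 * v) * ENNReal.ofReal (p * (N * Real.exp (-q - 1)))) ∂π :=
        lintegral_mono hpt
    _ = ENNReal.ofReal (4 * v * (2 * q + 1 + Real.log (1 / p))) * evidence v π x +
        ENNReal.ofReal (4 * v) * ENNReal.ofReal (p * (N * Real.exp (-q - 1))) := by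
        rw [lintegral_add_right _ measurable_const, lintegral_const_mul _ (by fun_prop), evidence]
        simp
    _ ≤ ENNReal.ofReal (4 * v * (2 * q + 1 + Real.log (1 / p))) * evidence v π x +
        ENNReal.ofReal (4 * v) * evidence v π x := by gcongr
    _ = _ := by
        rw [← add_mul, ← ENNReal.ofReal_add (by positivity) (by positivity)]
        congr 2
        rw [← hqv]
        ring

theorem integral_sq_gaussianReal (a : ℝ) (v : ℝ≥0) : ∫ x, x ^ 2 ∂(gaussianReal a v) = a ^ 2 + v := by
  have h := variance_fun_id_gaussianReal (μ := a) (v := v)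
  rw [variance_eq_sub (X := fun x : ℝ => x) (memLp_id_gaussianReal 2)] at h
  simp only [Pi.pow_apply] at h
  have h2 := integral_id_gaussianReal (μ := a) (v := v)
  rw [h2] at h
  linarith

theorem integrable_sq_gaussianReal (a : ℝ) (v : ℝ≥0) :
    Integrable (fun x => x ^ 2) (gaussianReal a v) :=
  (memLp_id_gaussianReal (μ := a) (v := v) 2).integrable_sq

theorem lintegral_sq_gaussianReal (a : ℝ) (v : ℝ≥0) :
    ∫⁻ x, ENNReal.ofReal (x ^ 2) ∂(gaussianReal a v) = ENNReal.ofReal (a ^ 2 + v) := by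
  rw [← ofReal_integral_eq_lintegral_ofReal (integrable_sq_gaussianReal a v)
    (ae_of_all _ fun _ => sq_nonneg _), integral_sq_gaussianReal]

theorem lintegral_sq_sub_gaussianReal (a : ℝ) (v : ℝ≥0) :
    ∫⁻ x, ENNReal.ofReal ((x - a) ^ 2) ∂(gaussianReal a v) = ENNReal.ofReal v := by
  have h := lintegral_map (μ := gaussianReal a v) (f := fun y : ℝ => ENNReal.ofReal (y ^ 2))
    (g := fun x => x - a) (by fun_prop) (by fun_prop)
  rw [← h, gaussianReal_map_sub_const, lintegral_sq_gaussianReal]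
  simp

theorem HeavyTailed.measurable {h : ℝ → ℝ} {c₁ κ : ℝ} (hh : HeavyTailed h c₁ κ) :
    Measurable h := by
  have hg : Antitone fun x => h (max x 0) := fun x y hxy =>
    hh.decreasing (Set.mem_Ici.2 (le_max_right _ _)) (Set.mem_Ici.2 (le_max_right _ _))
      (max_le_max_right 0 hxy)
  have : h = fun x => h (max |x| 0) := by
    ext x
    rw [max_eq_left (abs_nonneg x)]
    rcases abs_choice x with e | e <;> rw [e]
    exact (hh.symm x).symm
  rw [this]
  exact hg.measurable.comp measurable_abs

theorem HeavyTailed.apply_abs {h : ℝ → ℝ} {c₁ κ : ℝ} (hh : HeavyTailed h c₁ κ) (x : ℝ) :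
    h |x| = h x := by
  rcases abs_choice x with e | e <;> rw [e]
  exact hh.symm x

theorem gaussianPDFReal_swap (a : ℝ) (v : ℝ≥0) (x : ℝ) :
    gaussianPDFReal a v x = gaussianPDFReal x v a := by
  rw [gaussianPDFReal, gaussianPDFReal, show (x - a) ^ 2 = (a - x) ^ 2 by ring]

theorem integrable_sub_sq_mul_gaussianPDFReal {v : ℝ≥0} (hv : v ≠ 0) (x c : ℝ) :
    Integrable fun w => (c - w ^ 2) * gaussianPDFReal x v w := by
  have := (integrable_const c).sub (integrable_sq_gaussianReal x v)
  rw [gaussianReal_of_var_ne_zero _ hv, integrable_withDensity_iff_integrable_smul'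
    (measurable_gaussianPDF x v) (ae_of_all _ fun _ => gaussianPDF_lt_top)] at this
  refine this.congr (ae_of_all _ fun w => ?_)
  simp [mul_comm]

theorem integral_sub_sq_mul_gaussianPDFReal {v : ℝ≥0} (hv : v ≠ 0) (x : ℝ) :
    ∫ w, ((x ^ 2 + v) - w ^ 2) * gaussianPDFReal x v w = 0 := by
  have h := integral_sub (integrable_const (x ^ 2 + (v : ℝ))) (integrable_sq_gaussianReal x v)
  rw [integral_sq_gaussianReal, integral_gaussianReal_eq_integral_smul hv] at h
  simp only [smul_eq_mul, integral_const, probReal_univ, one_mul, sub_self] at h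
  rw [← h]
  exact integral_congr_ae (ae_of_all _ fun w => mul_comm _ _)

/-- For a symmetric unimodal prior, the posterior second moment is at most the one for the flat
prior. -/
theorem lintegral_sq_coordPosterior_le {H : Measure ℝ} [IsProbabilityMeasure H] {h : ℝ → ℝ}
    {c₁ κ : ℝ} (hH : HasDensity H h) (hh : HeavyTailed h c₁ κ) {v : ℝ≥0} (hv : v ≠ 0) {s : ℝ}
    (hs : 0 ≤ s) (x : ℝ) :
    ∫⁻ θ, ENNReal.ofReal (θ ^ 2) ∂(coordPosterior v (coordPrior H s) x) ≤
      ENNReal.ofReal (x ^ 2 + v) := by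
  refine lintegral_coordPosterior_le _ (by fun_prop) x ?_
  have hv0 : (0 : ℝ) < v := by exact_mod_cast pos_iff_ne_zero.2 hv
  have hmeas := hh.measurable
  rw [evidence, coordPrior, lintegral_map (by fun_prop) (by fun_prop),
    lintegral_map (by fun_prop) (by fun_prop)]
  -- Scale zero, a point mass at the origin, occurs for the truncated prior.
  rcases hs.eq_or_lt with rfl | hs
  · simp
  obtain ⟨M, hM⟩ := hh.bounded
  have hM0 : 0 ≤ M := (hh.pos 0).le.trans (hM 0)
  set φ : ℝ → ℝ := fun z => gaussianPDFReal x v (s * z) with hφ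
  have hφm : Measurable φ := (measurable_gaussianPDFReal x v).comp (by fun_prop)
  have hφ0 : ∀ z, 0 ≤ φ z := fun z => gaussianPDFReal_nonneg _ _ _
  have hφint : ∀ c : ℝ, Integrable fun z => (c - (s * z) ^ 2) * φ z := fun c =>
    (integrable_sub_sq_mul_gaussianPDFReal hv x c).comp_mul_left' hs.ne'
  have hφint0 : Integrable φ := (integrable_gaussianPDFReal x v).comp_mul_left' hs.ne'
  have hbd : ∀ᵐ z, ‖h z‖ ≤ M := ae_of_all _ fun z => by
    rw [Real.norm_of_nonneg (hh.pos z).le]; exact hM z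
  have hψ : ∀ {ψ : ℝ → ℝ}, Integrable ψ → Integrable fun z => ψ z * h z := fun hψ =>
    hψ.mul_bdd (c := M) hmeas.aestronglyMeasurable hbd
  have hsq : Integrable fun z => (s * z) ^ 2 * φ z := by
    refine (hφint 0).neg.congr (ae_of_all _ fun z => ?_)
    simp
  have e1 : ∫⁻ z, ENNReal.ofReal ((s * z) ^ 2) * gaussianPDF (s * z) v x ∂H =
      ENNReal.ofReal (∫ z, (s * z) ^ 2 * φ z * h z) := by
    rw [hH, lintegral_withDensity_eq_lintegral_mul _ (by fun_prop) (by fun_prop),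
      ofReal_integral_eq_lintegral_ofReal (hψ hsq) (ae_of_all _ fun z => by
        have := hφ0 z; have := (hh.pos z).le; positivity)]
    refine lintegral_congr fun z => ?_
    rw [Pi.mul_apply, gaussianPDF, gaussianPDFReal_swap,
      ENNReal.ofReal_mul (mul_nonneg (sq_nonneg _) (hφ0 z)), ENNReal.ofReal_mul (sq_nonneg _),
      mul_comm]
  have e2 : ∫⁻ z, gaussianPDF (s * z) v x ∂H = ENNReal.ofReal (∫ z, φ z * h z) := by
    rw [hH, lintegral_withDensity_eq_lintegral_mul _ (by fun_prop) (by fun_prop),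
      ofReal_integral_eq_lintegral_ofReal (hψ hφint0) (ae_of_all _ fun z =>
        mul_nonneg (hφ0 z) (hh.pos z).le)]
    refine lintegral_congr fun z => ?_
    rw [Pi.mul_apply, gaussianPDF, gaussianPDFReal_swap, ENNReal.ofReal_mul (hφ0 z), mul_comm]
  rw [e1, e2, ← ENNReal.ofReal_mul (by positivity), ← integral_const_mul]
  refine ENNReal.ofReal_le_ofReal (sub_nonneg.1 ?_)
  rw [← integral_sub ((hψ hφint0).const_mul _) (hψ hsq)]
  -- The factor `x² + v - (s z)²` changes sign at `|z| = r`, and so does `h z - h r`, in the same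
  -- direction. Replacing `h z` by the constant `h r` therefore only decreases the integral, and the
  -- result is the flat-prior integral, which vanishes.
  set r := √(x ^ 2 + v) / s with hr
  have hr0 : 0 ≤ r := by positivity
  have hsr : (s * r) ^ 2 = x ^ 2 + v := by
    rw [hr, mul_div_cancel₀ _ hs.ne', Real.sq_sqrt (by positivity)]
  have hzero : ∫ z, ((x ^ 2 + v) - (s * z) ^ 2) * φ z * h r = 0 := by
    rw [integral_mul_const]
    have := Measure.integral_comp_mul_left
      (fun w => ((x ^ 2 + v) - w ^ 2) * gaussianPDFReal x v w) s
    rw [integral_sub_sq_mul_gaussianPDFReal hv, smul_zero] at this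
    rw [hφ, this, zero_mul]
  rw [← hzero]
  refine integral_mono ((hφint _).mul_const _)
    (((hψ hφint0).const_mul _).sub (hψ hsq)) fun z => ?_
  have key : 0 ≤ ((x ^ 2 + v) - (s * z) ^ 2) * (h z - h r) := by
    rw [← hsr, ← hh.apply_abs z]
    rcases le_total |z| r with hz | hz
    · refine mul_nonneg ?_ (sub_nonneg.2 (hh.decreasing (abs_nonneg z) hr0 hz))
      rw [mul_pow, mul_pow, ← sq_abs z]
      have := pow_le_pow_left₀ (abs_nonneg z) hz 2
      nlinarith [sq_nonneg s]
    · refine mul_nonneg_of_nonpos_of_nonpos ?_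
        (sub_nonpos.2 (hh.decreasing hr0 (abs_nonneg z) hz))
      rw [mul_pow, mul_pow, ← sq_abs z]
      have := pow_le_pow_left₀ hr0 hz 2
      nlinarith [sq_nonneg s]
  show ((x ^ 2 + v) - (s * z) ^ 2) * φ z * h r ≤
    (x ^ 2 + v) * (φ z * h z) - (s * z) ^ 2 * φ z * h z
  nlinarith [mul_nonneg key (hφ0 z)]

/-- Jensen's inequality for the likelihood ratio against `θ = 0`: its logarithm `θ x / v - θ² /
(2v)` has prior mean `-V / (2v)` for a centred prior with second moment `V`, whatever `x` is. -/
theorem evidence_ge {v : ℝ≥0} (hv : v ≠ 0) (π : Measure ℝ) [IsProbabilityMeasure π]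
    (h1 : Integrable (fun θ => θ) π) (hmean : ∫ θ, θ ∂π = 0)
    (h2 : Integrable (fun θ => θ ^ 2) π) (x : ℝ) :
    ENNReal.ofReal (gaussianPDFReal 0 v x * Real.exp (-(∫ θ, θ ^ 2 ∂π) / (2 * v))) ≤
      evidence v π x := by
  have hv0 : (0 : ℝ) < v := by exact_mod_cast pos_iff_ne_zero.2 hv
  set V := ∫ θ, θ ^ 2 ∂π with hV
  -- The tangent to the exponential at `-V / (2v)`, a quadratic in `θ`. It can be negative, hence
  -- the positive part at the end.
  set ψ : ℝ → ℝ := fun θ => gaussianPDFReal 0 v x * Real.exp (-V / (2 * v)) *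
    ((1 + V / (2 * v)) + (x / v) * θ - (1 / (2 * v)) * θ ^ 2) with hψ
  have hψi : Integrable ψ π :=
    (((integrable_const _).add (h1.const_mul _)).sub (h2.const_mul _)).const_mul _
  have hψe : ∫ θ, ψ θ ∂π = gaussianPDFReal 0 v x * Real.exp (-V / (2 * v)) := by
    have e1 := integral_sub (((integrable_const (1 + V / (2 * v))).add (h1.const_mul (x / v))))
      (h2.const_mul (1 / (2 * (v : ℝ))))
    have e2 := integral_add (integrable_const (1 + V / (2 * v))) (h1.const_mul (x / v))
    simp only [Pi.add_apply] at e1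
    rw [hψ, integral_const_mul, e1, e2, integral_const_mul, integral_const_mul, hmean, ← hV]
    simp only [integral_const, probReal_univ, one_smul]
    ring
  have hle : ∀ θ, ψ θ ≤ gaussianPDFReal θ v x := by
    intro θ
    rw [← gaussianPDFReal_mul_exp 0 θ hv x]
    simp only [hψ]
    rw [mul_assoc]
    refine mul_le_mul_of_nonneg_left ?_ (gaussianPDFReal_nonneg _ _ _)
    set y := (θ - 0) * x / v - (θ ^ 2 - 0 ^ 2) / (2 * v) with hy
    have := Real.add_one_le_exp (y + V / (2 * v))
    calc Real.exp (-V / (2 * v)) * ((1 + V / (2 * v)) + (x / v) * θ - (1 / (2 * v)) * θ ^ 2)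
        = Real.exp (-V / (2 * v)) * (y + V / (2 * v) + 1) := by rw [hy]; ring
      _ ≤ Real.exp (-V / (2 * v)) * Real.exp (y + V / (2 * v)) := by gcongr
      _ = Real.exp y := by rw [← Real.exp_add]; congr 1; ring
  rw [← hψe]
  calc ENNReal.ofReal (∫ θ, ψ θ ∂π) ≤ ENNReal.ofReal (∫ θ, max (ψ θ) 0 ∂π) :=
        ENNReal.ofReal_le_ofReal
          (integral_mono hψi hψi.pos_part fun θ => le_max_left _ _)
    _ = ∫⁻ θ, ENNReal.ofReal (max (ψ θ) 0) ∂π :=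
        ofReal_integral_eq_lintegral_ofReal hψi.pos_part (ae_of_all _ fun _ => le_max_right _ _)
    _ ≤ evidence v π x := lintegral_mono fun θ => ENNReal.ofReal_le_ofReal
        (max_le (hle θ) (gaussianPDFReal_nonneg _ _ _))

theorem lintegral_gaussianReal {a : ℝ} {v : ℝ≥0} (hv : v ≠ 0) {g : ℝ → ℝ≥0∞} (hg : Measurable g) :
    ∫⁻ x, g x ∂(gaussianReal a v) = ∫⁻ x, gaussianPDF a v x * g x := by
  rw [gaussianReal_of_var_ne_zero _ hv, lintegral_withDensity_eq_lintegral_mul _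
    (measurable_gaussianPDF a v) hg]
  rfl

theorem measurable_lintegral_coordPosterior (v : ℝ≥0) (π : Measure ℝ) [SFinite π]
    {g : ℝ → ℝ≥0∞} (hg : Measurable g) :
    Measurable fun x => ∫⁻ θ, g θ ∂(coordPosterior v π x) :=
  hg.lintegral_kernel

/-- The posterior second moment averaged over data generated by the parameter zero. -/
theorem lintegral_lintegral_sq_coordPosterior_zero_le {v : ℝ≥0} (hv : v ≠ 0) (π : Measure ℝ)
    [IsProbabilityMeasure π] (h1 : Integrable (fun θ => θ) π) (hmean : ∫ θ, θ ∂π = 0)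
    (h2 : Integrable (fun θ => θ ^ 2) π) :
    ∫⁻ x, ∫⁻ θ, ENNReal.ofReal (θ ^ 2) ∂(coordPosterior v π x) ∂(gaussianReal 0 v) ≤
      ENNReal.ofReal (Real.exp ((∫ θ, θ ^ 2 ∂π) / (2 * v)) * ∫ θ, θ ^ 2 ∂π) := by
  have hsq : Measurable fun θ : ℝ => ENNReal.ofReal (θ ^ 2) := by fun_prop
  set V := ∫ θ, θ ^ 2 ∂π with hV
  rw [lintegral_gaussianReal hv (measurable_lintegral_coordPosterior v π hsq)]
  -- By `evidence_ge` the data density at zero is at most a constant times the posterior's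
  -- normalising denominator. After this cancellation, integrating out `x` leaves the prior second
  -- moment.
  have hpt : ∀ x, gaussianPDF 0 v x * ∫⁻ θ, ENNReal.ofReal (θ ^ 2) ∂(coordPosterior v π x) ≤
      ENNReal.ofReal (Real.exp (V / (2 * v))) *
        ∫⁻ θ, ENNReal.ofReal (θ ^ 2) * gaussianPDF θ v x ∂π := by
    intro x
    rw [lintegral_coordPosterior v π hsq, ← mul_div_assoc]
    refine ENNReal.div_le_of_le_mul ?_
    rw [mul_right_comm]
    gcongr
    calc gaussianPDF 0 v x = ENNReal.ofReal (Real.exp (V / (2 * v))) *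
          ENNReal.ofReal (gaussianPDFReal 0 v x * Real.exp (-V / (2 * v))) := by
          rw [← ENNReal.ofReal_mul (Real.exp_nonneg _), mul_left_comm, ← Real.exp_add, gaussianPDF]
          congr 1
          rw [neg_div, add_neg_cancel, Real.exp_zero, mul_one]
      _ ≤ _ := by
          gcongr
          exact evidence_ge hv π h1 hmean h2 x
  refine (lintegral_mono hpt).trans ?_
  rw [lintegral_const_mul' _ _ ENNReal.ofReal_ne_top, ENNReal.ofReal_mul (Real.exp_nonneg _)]
  gcongr
  rw [lintegral_lintegral_swap]
  · rw [hV, ofReal_integral_eq_lintegral_ofReal h2 (ae_of_all _ fun _ => sq_nonneg _)]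
    refine lintegral_mono fun θ => ?_
    rw [lintegral_const_mul _ (measurable_gaussianPDF θ v), lintegral_gaussianPDF_eq_one θ hv,
      mul_one]
  · exact ((hsq.comp measurable_snd).mul
      ((measurable_gaussianPDF_mean v).comp measurable_swap)).aemeasurable

theorem exists_lintegral_pow_four_gaussianReal_le :
    ∃ C : ℝ, 0 ≤ C ∧ ∀ (a : ℝ) (v : ℝ≥0),
      ∫⁻ x, ENNReal.ofReal (x ^ 4) ∂(gaussianReal a v) ≤
        ENNReal.ofReal (8 * (a ^ 4 + v ^ 2 * C)) := by
  have hint : Integrable (fun z : ℝ => z ^ 4) (gaussianReal 0 1) := by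
    have := (memLp_id_gaussianReal (μ := 0) (v := 1) 4).integrable_norm_pow (by norm_num)
    refine this.congr (ae_of_all _ fun z => ?_)
    have : ‖id z‖ ^ 4 = z ^ 4 := by
      rw [id, Real.norm_eq_abs, show (4 : ℕ) = 2 * 2 by norm_num, pow_mul, pow_mul, sq_abs]
    exact this
  have hnn : ∀ z : ℝ, 0 ≤ z ^ 4 := fun z => by positivity
  refine ⟨∫ z, z ^ 4 ∂(gaussianReal 0 1), integral_nonneg hnn, fun a v => ?_⟩
  have hmap : gaussianReal a v = (gaussianReal 0 1).map (fun z => a + √v * z) := by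
    have e : (fun z : ℝ => a + √v * z) = (fun z => a + z) ∘ (fun z => √v * z) := rfl
    rw [e, ← Measure.map_map (by fun_prop) (by fun_prop), gaussianReal_map_const_mul,
      gaussianReal_map_const_add]
    congr 1
    · simp
    · ext
      simp
  rw [hmap, lintegral_map (by fun_prop) (by fun_prop)]
  have hi : Integrable (fun z : ℝ => 8 * (a ^ 4 + v ^ 2 * z ^ 4)) (gaussianReal 0 1) :=
    ((integrable_const _).add (hint.const_mul _)).const_mul _
  calc ∫⁻ z, ENNReal.ofReal ((a + √v * z) ^ 4) ∂(gaussianReal 0 1)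
      ≤ ∫⁻ z, ENNReal.ofReal (8 * (a ^ 4 + v ^ 2 * z ^ 4)) ∂(gaussianReal 0 1) := by
        refine lintegral_mono fun z => ENNReal.ofReal_le_ofReal ?_
        have e : (v : ℝ) ^ 2 * z ^ 4 = (√v * z) ^ 4 := by
          rw [mul_pow, show (√(v : ℝ)) ^ 4 = ((√(v : ℝ)) ^ 2) ^ 2 by ring,
            Real.sq_sqrt v.coe_nonneg]
        rw [e]
        set b := √(v : ℝ) * z
        have h1 : (a + b) ^ 2 ≤ 2 * (a ^ 2 + b ^ 2) := by nlinarith [sq_nonneg (a - b)]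
        have h2 := pow_le_pow_left₀ (sq_nonneg _) h1 2
        nlinarith [sq_nonneg (a ^ 2 - b ^ 2)]
    _ = ENNReal.ofReal (∫ z, 8 * (a ^ 4 + v ^ 2 * z ^ 4) ∂(gaussianReal 0 1)) :=
        (ofReal_integral_eq_lintegral_ofReal hi (ae_of_all _ fun z => by
          have := hnn z; have := hnn a; positivity)).symm
    _ = _ := by
        rw [integral_const_mul, integral_add (integrable_const _) (hint.const_mul _),
          integral_const_mul]
        simp

/-- Change of the centre of a Gaussian law in the integral of a function with quadratic growth. -/
theorem exists_lintegral_gaussianReal_le :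
    ∃ C : ℝ, 0 ≤ C ∧ ∀ (a : ℝ) (v : ℝ≥0), v ≠ 0 → ∀ F : ℝ → ℝ≥0∞, Measurable F →
      (∀ x, F x ≤ ENNReal.ofReal (x ^ 2 + v)) →
      ∫⁻ x, F x ∂(gaussianReal a v) ≤
        ENNReal.ofReal (Real.exp 1) * ∫⁻ x, F x ∂(gaussianReal 0 v) +
          ENNReal.ofReal (C * a ^ 2) := by
  obtain ⟨C, hC, hC4⟩ := exists_lintegral_pow_four_gaussianReal_le
  refine ⟨10 + 8 * C, by positivity, fun a v hv F hF hFle => ?_⟩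
  have hv0 : (0 : ℝ) < v := by exact_mod_cast pos_iff_ne_zero.2 hv
  rcases le_or_gt (a ^ 2) v with hav | hav
  · have hpt : ∀ x, gaussianPDF a v x * F x ≤
        ENNReal.ofReal (Real.exp 1) * (gaussianPDF 0 v x * F x) +
        gaussianPDF a v x *
          (ENNReal.ofReal (a ^ 2 / v ^ 2) * ENNReal.ofReal (x ^ 4) +
            ENNReal.ofReal (a ^ 2 / v) * ENNReal.ofReal (x ^ 2)) := by
      intro x
      -- If `a x ≤ v`, the likelihood ratio is at most `e`. Otherwise `a x / v > 1`, and the growth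
      -- bound may be multiplied by `(a x / v)²`; this supplies the factor `a²` and calls for the
      -- fourth moment.
      rcases le_or_gt (a * x) v with hx | hx
      · refine le_trans ?_ le_self_add
        rw [← mul_assoc]
        gcongr
        rw [gaussianPDF, gaussianPDF, ← ENNReal.ofReal_mul (Real.exp_nonneg _),
          ← gaussianPDFReal_mul_exp 0 a hv x, mul_comm]
        refine ENNReal.ofReal_le_ofReal ?_
        refine mul_le_mul_of_nonneg_right ?_ (gaussianPDFReal_nonneg _ _ _)
        refine Real.exp_le_exp.2 ?_
        have h1 : (a - 0) * x / v ≤ 1 := by rw [div_le_one hv0]; linarith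
        have h2 : 0 ≤ (a ^ 2 - 0 ^ 2) / (2 * (v : ℝ)) := by
          rw [zero_pow two_ne_zero, sub_zero]; positivity
        linarith
      · refine le_trans ?_ le_add_self
        gcongr
        refine (hFle x).trans ?_
        have hx4 : 0 ≤ x ^ 4 := by positivity
        rw [← ENNReal.ofReal_mul (by positivity), ← ENNReal.ofReal_mul (by positivity),
          ← ENNReal.ofReal_add (by positivity) (by positivity)]
        refine ENNReal.ofReal_le_ofReal ?_
        have h1 : 1 ≤ (a * x / v) ^ 2 := by
          refine one_le_pow₀ ?_
          rw [le_div_iff₀ hv0]; linarith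
        calc x ^ 2 + v ≤ (x ^ 2 + v) * (a * x / v) ^ 2 :=
              le_mul_of_one_le_right (by positivity) h1
          _ = _ := by field_simp
    rw [lintegral_gaussianReal hv hF, lintegral_gaussianReal hv hF]
    refine (lintegral_mono hpt).trans ?_
    have hm : Measurable fun x : ℝ => ENNReal.ofReal (a ^ 2 / v ^ 2) * ENNReal.ofReal (x ^ 4) +
            ENNReal.ofReal (a ^ 2 / v) * ENNReal.ofReal (x ^ 2) := by fun_prop
    have hm' : Measurable fun x : ℝ => gaussianPDF a v x *
        (ENNReal.ofReal (a ^ 2 / v ^ 2) * ENNReal.ofReal (x ^ 4) +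
            ENNReal.ofReal (a ^ 2 / v) * ENNReal.ofReal (x ^ 2)) :=
      (measurable_gaussianPDF a v).mul hm
    rw [lintegral_add_right _ hm', lintegral_const_mul' _ _ ENNReal.ofReal_ne_top,
      ← lintegral_gaussianReal hv hm,
      lintegral_add_right _ (by fun_prop), lintegral_const_mul _ (by fun_prop),
      lintegral_const_mul _ (by fun_prop), lintegral_sq_gaussianReal]
    gcongr
    calc _ ≤ ENNReal.ofReal (a ^ 2 / v ^ 2) * ENNReal.ofReal (8 * (a ^ 4 + v ^ 2 * C)) +
          ENNReal.ofReal (a ^ 2 / v) * ENNReal.ofReal (a ^ 2 + v) := by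
          gcongr
          exact hC4 a v
      _ ≤ _ := by
          have ha4 : 0 ≤ a ^ 4 := by positivity
          rw [← ENNReal.ofReal_mul (by positivity), ← ENNReal.ofReal_mul (by positivity),
            ← ENNReal.ofReal_add (by positivity) (by positivity)]
          refine ENNReal.ofReal_le_ofReal ?_
          have hr : a ^ 2 / v ≤ 1 := (div_le_one hv0).2 hav
          have hr0 : 0 ≤ a ^ 2 / v := by positivity
          have e : a ^ 2 / v ^ 2 * (8 * (a ^ 4 + v ^ 2 * C)) + a ^ 2 / v * (a ^ 2 + v) =
              a ^ 2 * (8 * (a ^ 2 / v) ^ 2 + 8 * C + a ^ 2 / v + 1) := by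
            field_simp
            ring
          rw [e, mul_comm _ (a ^ 2)]
          refine mul_le_mul_of_nonneg_left ?_ (sq_nonneg a)
          nlinarith
  -- With `v < a²`, quadratic growth alone gives `a² + 2v ≤ 3a²`.
  · refine le_trans ?_ le_add_self
    calc ∫⁻ x, F x ∂(gaussianReal a v)
        ≤ ∫⁻ x, (ENNReal.ofReal (x ^ 2) + ENNReal.ofReal v) ∂(gaussianReal a v) := by
          refine lintegral_mono fun x => (hFle x).trans ?_
          rw [ENNReal.ofReal_add (sq_nonneg _) hv0.le]
      _ = ENNReal.ofReal (a ^ 2 + v + v) := by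
          rw [lintegral_add_right _ measurable_const, lintegral_sq_gaussianReal,
            ENNReal.ofReal_add (p := a ^ 2 + v) (by positivity) hv0.le]
          simp
      _ ≤ _ := ENNReal.ofReal_le_ofReal (by nlinarith [mul_nonneg hC (sq_nonneg a)])

end Univariate

/-! ### The two bounds for the risk of one coordinate -/

section CoordinateRisk

theorem HasDensity.integrable_sq {H : Measure ℝ} {h : ℝ → ℝ} {c₁ κ : ℝ} (hH : HasDensity H h)
    (hh : HeavyTailed h c₁ κ) (hmom : Integrable (fun x : ℝ => |x| ^ 2 * h x)) :
    Integrable (fun x => x ^ 2) H := by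
  have := hh.measurable
  rw [hH, integrable_withDensity_iff_integrable_smul' (by fun_prop)
    (ae_of_all _ fun _ => ENNReal.ofReal_lt_top)]
  refine hmom.congr (ae_of_all _ fun x => ?_)
  simp only [smul_eq_mul, sq_abs]
  rw [ENNReal.toReal_ofReal (hh.pos x).le, mul_comm]

theorem HasDensity.integral_id_eq_zero {H : Measure ℝ} {h : ℝ → ℝ} {c₁ κ : ℝ}
    (hH : HasDensity H h) (hh : HeavyTailed h c₁ κ) : ∫ x, x ∂H = 0 := by
  have hm := hh.measurable
  rw [hH, integral_withDensity_eq_integral_toReal_smul (by fun_prop)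
    (ae_of_all _ fun _ => ENNReal.ofReal_lt_top)]
  have e := integral_neg_eq_self (fun x => (ENNReal.ofReal (h x)).toReal • x) volume
  simp only [hh.symm, smul_neg, integral_neg] at e
  linarith

theorem coordPrior_moments {H : Measure ℝ} [IsProbabilityMeasure H]
    (h2 : Integrable (fun x => x ^ 2) H) (h0 : ∫ x, x ∂H = 0) (s : ℝ) :
    Integrable (fun θ => θ) (coordPrior H s) ∧ ∫ θ, θ ∂(coordPrior H s) = 0 ∧
      Integrable (fun θ => θ ^ 2) (coordPrior H s) ∧
      ∫ θ, θ ^ 2 ∂(coordPrior H s) = s ^ 2 * ∫ x, x ^ 2 ∂H := by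
  have hm : Measurable fun z : ℝ => s * z := by fun_prop
  have h1 : Integrable (fun x : ℝ => x) H :=
    ((memLp_two_iff_integrable_sq aestronglyMeasurable_id).2 h2).integrable one_le_two
  refine ⟨?_, ?_, ?_, ?_⟩
  · rw [coordPrior, integrable_map_measure (by fun_prop) hm.aemeasurable]
    exact h1.const_mul s
  · rw [coordPrior, integral_map hm.aemeasurable (by fun_prop), integral_const_mul, h0, mul_zero]
  · rw [coordPrior, integrable_map_measure (by fun_prop) hm.aemeasurable]
    refine (h2.const_mul (s ^ 2)).congr (ae_of_all _ fun x => ?_)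
    simp [mul_pow]
  · rw [coordPrior, integral_map hm.aemeasurable (by fun_prop), ← integral_const_mul]
    simp [mul_pow]

/-- The mean squared error of the posterior of a coordinate whose prior scale is at most of the
order of the noise level. -/
theorem exists_coordRisk_le_of_small_scale {H : Measure ℝ} [IsProbabilityMeasure H] {h : ℝ → ℝ}
    {c₁ κ : ℝ} (hH : HasDensity H h) (hh : HeavyTailed h c₁ κ)
    (hmom : Integrable (fun x : ℝ => |x| ^ 2 * h x)) (T : ℝ) :
    ∃ C : ℝ, 0 ≤ C ∧ ∀ (v : ℝ≥0), v ≠ 0 → ∀ s a : ℝ, 0 ≤ s → s ^ 2 ≤ T * v →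
      ∫⁻ x, ∫⁻ θ, ENNReal.ofReal ((θ - a) ^ 2) ∂(coordPosterior v (coordPrior H s) x)
        ∂(gaussianReal a v) ≤ ENNReal.ofReal (C * (s ^ 2 + a ^ 2)) := by
  obtain ⟨C, hC, hCle⟩ := exists_lintegral_gaussianReal_le
  set m := ∫ x, x ^ 2 ∂H with hm
  have hm0 : 0 ≤ m := integral_nonneg fun _ => sq_nonneg _
  -- The factor `exp (V / (2v))` with `V = s² m` stays bounded because `s² ≤ T v`.
  set E := Real.exp 1 * (Real.exp (T * m / 2) * m) with hE
  have hE0 : 0 ≤ E := by positivity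
  refine ⟨2 * E + 2 * C + 2, by positivity, fun v hv s a hs hsT => ?_⟩
  have hv0 : (0 : ℝ) < v := by exact_mod_cast pos_iff_ne_zero.2 hv
  have hMk := isMarkovKernel_coordPosterior hv (coordPrior H s)
  obtain ⟨h1, hmean, h2, hV⟩ := coordPrior_moments (hH.integrable_sq hh hmom)
    (hH.integral_id_eq_zero hh) s
  have hsq : Measurable fun θ : ℝ => ENNReal.ofReal (θ ^ 2) := by fun_prop
  have hF := measurable_lintegral_coordPosterior v (coordPrior H s) hsq
  have hzero : ∫⁻ x, ∫⁻ θ, ENNReal.ofReal (θ ^ 2) ∂(coordPosterior v (coordPrior H s) x)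
      ∂(gaussianReal 0 v) ≤ ENNReal.ofReal (Real.exp (T * m / 2) * m * s ^ 2) := by
    refine (lintegral_lintegral_sq_coordPosterior_zero_le hv _ h1 hmean h2).trans
      (ENNReal.ofReal_le_ofReal ?_)
    rw [hV, ← hm, mul_assoc, mul_comm m]
    gcongr Real.exp ?_ * _
    rw [div_le_div_iff₀ (by positivity) two_pos]
    nlinarith [mul_le_mul_of_nonneg_right hsT hm0]
  calc ∫⁻ x, ∫⁻ θ, ENNReal.ofReal ((θ - a) ^ 2) ∂(coordPosterior v (coordPrior H s) x)
        ∂(gaussianReal a v)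
      ≤ ∫⁻ x, (2 * ∫⁻ θ, ENNReal.ofReal (θ ^ 2) ∂(coordPosterior v (coordPrior H s) x) +
          ENNReal.ofReal (2 * a ^ 2)) ∂(gaussianReal a v) := by
        refine lintegral_mono fun x => ?_
        calc ∫⁻ θ, ENNReal.ofReal ((θ - a) ^ 2) ∂(coordPosterior v (coordPrior H s) x)
            ≤ ∫⁻ θ, (2 * ENNReal.ofReal (θ ^ 2) + ENNReal.ofReal (2 * a ^ 2))
                ∂(coordPosterior v (coordPrior H s) x) := by
              refine lintegral_mono fun θ => ?_
              rw [← ENNReal.ofReal_ofNat 2, ← ENNReal.ofReal_mul two_pos.le,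
                ← ENNReal.ofReal_add (by positivity) (by positivity)]
              exact ENNReal.ofReal_le_ofReal (by nlinarith [sq_nonneg (θ + a)])
          _ = _ := by
              rw [lintegral_add_right _ measurable_const, lintegral_const_mul _ hsq]
              simp
    _ = 2 * ∫⁻ x, ∫⁻ θ, ENNReal.ofReal (θ ^ 2) ∂(coordPosterior v (coordPrior H s) x)
          ∂(gaussianReal a v) + ENNReal.ofReal (2 * a ^ 2) := by
        rw [lintegral_add_right _ measurable_const, lintegral_const_mul _ hF]
        simp
    _ ≤ 2 * (ENNReal.ofReal (Real.exp 1) * ENNReal.ofReal (Real.exp (T * m / 2) * m * s ^ 2) +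
          ENNReal.ofReal (C * a ^ 2)) + ENNReal.ofReal (2 * a ^ 2) := by
        gcongr
        -- The comparison with the flat prior supplies the quadratic growth needed to move the
        -- centre from zero to `a`.
        refine (hCle a v hv _ hF fun x => lintegral_sq_coordPosterior_le hH hh hv hs x).trans ?_
        gcongr
    _ = ENNReal.ofReal (2 * (E * s ^ 2 + C * a ^ 2) + 2 * a ^ 2) := by
        rw [← ENNReal.ofReal_mul (Real.exp_nonneg _),
          ← ENNReal.ofReal_add (by positivity) (by positivity), ← ENNReal.ofReal_ofNat 2,
          ← ENNReal.ofReal_mul two_pos.le, ← ENNReal.ofReal_add (by positivity) (by positivity), hE]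
        congr 4
        ring
    _ ≤ _ := by
        refine ENNReal.ofReal_le_ofReal ?_
        nlinarith [mul_nonneg hE0 (sq_nonneg a), mul_nonneg hC (sq_nonneg s), sq_nonneg s]

/-- Since `s ≤ 1`, multiplication by `s` maps the interval of length `√v` to the right of `a / s`
into the ball, and by unimodality `h` is there at least its value at `|a| / s + 1`. The loss from
using an interval shorter than the full preimage matters only inside a logarithm. -/
theorem coordPrior_ball_ge {H : Measure ℝ} [IsProbabilityMeasure H] {h : ℝ → ℝ} {c₁ κ : ℝ}
    (hH : HasDensity H h) (hh : HeavyTailed h c₁ κ) {v : ℝ≥0} (hv1 : v ≤ 1) {s : ℝ} (hs : 0 < s)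
    (hs1 : s ≤ 1) (a : ℝ) :
    ENNReal.ofReal (√v * h (|a| / s + 1)) ≤ coordPrior H s {θ | (θ - a) ^ 2 ≤ v} := by
  have hv1' : (v : ℝ) ≤ 1 := by exact_mod_cast hv1
  have hsv1 : √(v : ℝ) ≤ 1 := by rw [Real.sqrt_le_one]; exact hv1'
  have hms : MeasurableSet {θ : ℝ | (θ - a) ^ 2 ≤ v} :=
    measurableSet_le (by fun_prop) measurable_const
  rw [coordPrior, Measure.map_apply (by fun_prop) hms, hH]
  have hsub : Set.Icc (a / s) (a / s + √v) ⊆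
      (fun z => s * z) ⁻¹' {θ : ℝ | (θ - a) ^ 2 ≤ v} := by
    intro z hz
    show (s * z - a) ^ 2 ≤ v
    have h1 : 0 ≤ z - a / s := sub_nonneg.2 hz.1
    have h2 : z - a / s ≤ √v := by linarith [hz.2]
    have e : s * z - a = s * (z - a / s) := by field_simp
    rw [e, mul_pow]
    have h3 := pow_le_pow_left₀ h1 h2 2
    rw [Real.sq_sqrt v.coe_nonneg] at h3
    have h4 : s ^ 2 ≤ 1 := pow_le_one₀ hs.le hs1
    nlinarith [sq_nonneg (z - a / s), v.coe_nonneg]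
  refine le_trans ?_ (measure_mono hsub)
  rw [withDensity_apply _ measurableSet_Icc]
  calc ENNReal.ofReal (√v * h (|a| / s + 1))
      = ∫⁻ _ in Set.Icc (a / s) (a / s + √v), ENNReal.ofReal (h (|a| / s + 1)) := by
        rw [setLIntegral_const, Real.volume_Icc, add_sub_cancel_left, mul_comm,
          ENNReal.ofReal_mul (hh.pos _).le]
    _ ≤ _ := by
        refine setLIntegral_mono hh.measurable.ennreal_ofReal fun z hz => ?_
        refine ENNReal.ofReal_le_ofReal ?_
        rw [← hh.apply_abs z]
        refine hh.decreasing (Set.mem_Ici.2 (abs_nonneg z)) (Set.mem_Ici.2 (by positivity)) ?_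
        have h1 : |z| ≤ |a / s| + |z - a / s| := by
          have := abs_add_le (a / s) (z - a / s)
          rwa [add_sub_cancel] at this
        have h2 : |z - a / s| ≤ 1 := by
          rw [abs_of_nonneg (sub_nonneg.2 hz.1)]
          linarith [hz.2]
        rw [abs_div, abs_of_pos hs] at h1
        linarith

/-- The mean squared error of the posterior of a coordinate, up to a logarithmic factor of the order
of the noise level. -/
theorem coordRisk_le {H : Measure ℝ} [IsProbabilityMeasure H] {h : ℝ → ℝ} {c₁ κ : ℝ}
    (hc₁ : 0 < c₁) (hκ : 0 ≤ κ) (hH : HasDensity H h) (hh : HeavyTailed h c₁ κ) {v : ℝ≥0}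
    (hv : v ≠ 0) (hv1 : v ≤ 1) {s : ℝ} (hs : 0 < s) (hs1 : s ≤ 1) {a L l : ℝ} (ha : |a| ≤ L)
    (hl : Real.log (1 / s) ≤ l) :
    ∫⁻ x, ∫⁻ θ, ENNReal.ofReal ((θ - a) ^ 2) ∂(coordPosterior v (coordPrior H s) x)
      ∂(gaussianReal a v) ≤ ENNReal.ofReal (4 * v * (4 + (Real.log (1 / v) / 2 +
        c₁ * (1 + (Real.log (2 + L) + l) ^ (1 + κ))))) := by
  have hv0 : (0 : ℝ) < v := by exact_mod_cast pos_iff_ne_zero.2 hv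
  have hL : 0 ≤ L := (abs_nonneg a).trans ha
  set p := √(v : ℝ) * h (|a| / s + 1) with hp
  have hpos := hh.pos (|a| / s + 1)
  have hp0 : 0 < p := by positivity
  have hball := coordPrior_ball_ge hH hh hv1 hs hs1 a
  have hp1 : p ≤ 1 := by
    exact ENNReal.ofReal_le_one.1 (hball.trans prob_le_one)
  have hlogp0 : 0 ≤ Real.log (1 / p) := Real.log_nonneg (by rw [le_div_iff₀ hp0]; linarith)
  -- The tail condition enters here: as `1 / s ≥ 1`, the argument `2 + |a| / s` is at most `(2 + L)
  -- / s`, so the cost is a power of `log (1 / s)` and not of `1 / s`.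
  have hlogp : Real.log (1 / p) ≤
      Real.log (1 / v) / 2 + c₁ * (1 + (Real.log (2 + L) + l) ^ (1 + κ)) := by
    have e : Real.log (1 / p) = Real.log (1 / v) / 2 + Real.log (1 / h (|a| / s + 1)) := by
      rw [hp, one_div, one_div, one_div, Real.log_inv, Real.log_inv, Real.log_inv,
        Real.log_mul (by positivity) hpos.ne', Real.log_sqrt hv0.le]
      ring
    have hq : 0 ≤ |a| / s := by positivity
    rw [e]
    gcongr
    refine (hh.tail _ (by positivity)).trans ?_
    gcongr
    · exact Real.log_nonneg (by linarith)
    · calc Real.log (1 + (|a| / s + 1)) ≤ Real.log ((2 + L) * (1 / s)) := by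
            gcongr
            have h1 : |a| / s ≤ L / s := by gcongr
            have h2 : 1 ≤ 1 / s := by rw [le_div_iff₀ hs]; linarith
            have h3 : (2 + L) * (1 / s) = 2 * (1 / s) + L / s := by ring
            linarith
        _ = Real.log (2 + L) + Real.log (1 / s) :=
            Real.log_mul (by positivity) (by positivity)
        _ ≤ _ := by gcongr
  calc _ ≤ ∫⁻ x, (ENNReal.ofReal 8 * ENNReal.ofReal ((x - a) ^ 2) +
          ENNReal.ofReal (4 * v * (2 + Real.log (1 / p)))) ∂(gaussianReal a v) := by
        refine lintegral_mono fun x => ?_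
        refine (lintegral_sq_sub_coordPosterior_le hv _ a x hp0 hball).trans (le_of_eq ?_)
        rw [← ENNReal.ofReal_mul (by norm_num), ← ENNReal.ofReal_add (by positivity) (by positivity)]
        congr 1
        ring
    _ = ENNReal.ofReal (4 * v * (4 + Real.log (1 / p))) := by
        rw [lintegral_add_right _ measurable_const, lintegral_const_mul _ (by fun_prop),
          lintegral_sq_sub_gaussianReal, lintegral_const, measure_univ, mul_one,
          ← ENNReal.ofReal_mul (by norm_num), ← ENNReal.ofReal_add (by positivity) (by positivity)]
        congr 1
        ring
    _ ≤ _ := ENNReal.ofReal_le_ofReal (by gcongr)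

end CoordinateRisk

/-! ### Sums up to and beyond the cutoff -/

section Sums

theorem tsum_ite_cast_le_mul_le (K : ℝ) (c : ℝ≥0∞) :
    ∑' k : ℕ+, (if (k : ℝ) ≤ K then c else 0) ≤ ENNReal.ofReal K * c := by
  have e := tsum_pnat_eq_tsum_succ (f := fun i : ℕ => if (i : ℝ) ≤ K then c else 0)
  rw [e, tsum_eq_sum (s := Finset.range ⌊K⌋₊)]
  · rcases le_or_gt K 0 with hK | hK
    · simp [Nat.floor_of_nonpos hK]
    · calc _ ≤ ∑ _i ∈ Finset.range ⌊K⌋₊, c := by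
            refine Finset.sum_le_sum fun i _ => ?_
            split_ifs <;> simp
        _ = (⌊K⌋₊ : ℝ≥0∞) * c := by simp
        _ ≤ _ := by
            gcongr
            rw [← ENNReal.ofReal_natCast]
            exact ENNReal.ofReal_le_ofReal (Nat.floor_le hK.le)
  · intro i hi
    rw [if_neg]
    intro h
    have := Nat.le_floor h
    rw [Finset.mem_range] at hi
    omega

/-- Comparison with the integral over the cells `[k, k + 1)`, which for `k > K` are disjoint and lie
in `(K, ∞)`. On a cell `x ≤ 2k`, whence the factor `2 ^ (1 + s)`. -/
theorem exists_tsum_tail_rpow_le {s : ℝ} (hs : 0 < s) :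
    ∃ C : ℝ, 0 ≤ C ∧ ∀ K : ℝ, 0 < K →
      ∑' k : ℕ+, (if (k : ℝ) ≤ K then 0 else ENNReal.ofReal ((k : ℝ) ^ (-(1 + s)))) ≤
        ENNReal.ofReal (C * K ^ (-s)) := by
  refine ⟨2 ^ (1 + s) / s, by positivity, fun K hK => ?_⟩
  set g : ℝ → ℝ≥0∞ := fun x => ENNReal.ofReal (x ^ (-(1 + s))) with hg
  have hgm : Measurable g := by fun_prop
  set I : ℕ+ → Set ℝ := fun k => if (k : ℝ) ≤ K then ∅ else Set.Ico (k : ℝ) (k + 1) with hI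
  have hIm : ∀ k, MeasurableSet (I k) := fun k => by
    simp only [hI]; split_ifs <;> measurability
  have hpt : ∀ k : ℕ+, (if (k : ℝ) ≤ K then 0 else ENNReal.ofReal ((k : ℝ) ^ (-(1 + s)))) ≤
      ENNReal.ofReal (2 ^ (1 + s)) * ∫⁻ x in I k, g x := by
    intro k
    have hk1 : (1 : ℝ) ≤ k := by exact_mod_cast (one_le : 1 ≤ k)
    have hk0 : (0 : ℝ) < k := by linarith
    by_cases hk : (k : ℝ) ≤ K
    · simp [hk]
    · simp only [hk, if_false, hI]
      calc ENNReal.ofReal ((k : ℝ) ^ (-(1 + s)))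
          = ENNReal.ofReal (2 ^ (1 + s)) * ∫⁻ _ in Set.Ico (k : ℝ) (k + 1),
              ENNReal.ofReal ((2 * (k : ℝ)) ^ (-(1 + s))) := by
            rw [setLIntegral_const, Real.volume_Ico, add_sub_cancel_left, ENNReal.ofReal_one,
              mul_one, ← ENNReal.ofReal_mul (by positivity),
              Real.mul_rpow two_pos.le hk0.le, ← mul_assoc, ← Real.rpow_add two_pos]
            simp
        _ ≤ _ := by
            gcongr ENNReal.ofReal (2 ^ (1 + s)) * ?_
            refine setLIntegral_mono hgm fun x hx => ENNReal.ofReal_le_ofReal ?_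
            exact Real.rpow_le_rpow_of_nonpos (by linarith [hx.1]) (by linarith [hx.2])
              (by linarith)
  have hdisj : Pairwise (Function.onFun Disjoint I) := by
    intro i j hij
    refine Set.disjoint_left.2 fun x hxi hxj => hij ?_
    simp only [hI] at hxi hxj
    split_ifs at hxi hxj with h1 h2
    all_goals first | exact absurd hxi (Set.notMem_empty x) | exact absurd hxj (Set.notMem_empty x)
                    | skip
    have h3 : (i : ℝ) < j + 1 := hxi.1.trans_lt hxj.2
    have h4 : (j : ℝ) < i + 1 := hxj.1.trans_lt hxi.2
    have h3' : (i : ℕ) < j + 1 := by exact_mod_cast h3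
    have h4' : (j : ℕ) < i + 1 := by exact_mod_cast h4
    exact PNat.eq (by omega)
  have hlt : -(1 + s) < -1 := by linarith
  calc _ ≤ ∑' k, ENNReal.ofReal (2 ^ (1 + s)) * ∫⁻ x in I k, g x := ENNReal.tsum_le_tsum hpt
    _ = ENNReal.ofReal (2 ^ (1 + s)) * ∫⁻ x in ⋃ k, I k, g x := by
        rw [ENNReal.tsum_mul_left, lintegral_iUnion hIm hdisj]
    _ ≤ ENNReal.ofReal (2 ^ (1 + s)) * ∫⁻ x in Set.Ioi K, g x := by
        gcongr
        refine Set.iUnion_subset fun k x hx => ?_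
        simp only [hI] at hx
        split_ifs at hx with h1
        · exact absurd hx (Set.notMem_empty x)
        · exact (not_le.1 h1).trans_le hx.1
    _ = ENNReal.ofReal (2 ^ (1 + s)) * ENNReal.ofReal (K ^ (-s) / s) := by
        rw [← ofReal_integral_eq_lintegral_ofReal (integrableOn_Ioi_rpow_of_lt hlt hK)
          ((ae_restrict_iff' measurableSet_Ioi).2 (ae_of_all _ fun x hx =>
            Real.rpow_nonneg (hK.trans hx).le _)), integral_Ioi_rpow_of_lt hlt hK]
        congr 2
        rw [show -(1 + s) + 1 = -s by ring, neg_div_neg_eq]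
    _ = _ := by
        rw [← ENNReal.ofReal_mul (by positivity)]
        congr 1
        ring

end Sums

/-! ### From coordinate risks to posterior contraction -/

section Contraction

/-- Markov's inequality for the posterior mass outside a ball. -/
theorem lintegral_posteriorLaw_le {n : ℕ} (hn : n ≠ 0) (H : Measure ℝ) [IsProbabilityMeasure H]
    {σ : ℕ+ → ℝ} (hσ : Summable fun k => σ k ^ 2) (hH : ∫⁻ x, ENNReal.ofReal (x ^ 2) ∂H ≠ ∞)
    {f₀ : ℕ+ → ℝ} (hf₀ : Summable fun k => f₀ k ^ 2) {δ : ℝ} (hδ : 0 < δ) :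
    ∫⁻ X, posteriorLaw n (prior H σ) X {f | ENNReal.ofReal δ < l2norm (f - f₀)}
        ∂(dataLaw n f₀) ≤
      (∑' k, ∫⁻ x, ∫⁻ θ, ENNReal.ofReal ((θ - f₀ k) ^ 2)
        ∂(coordPosterior (1 / (n : ℝ≥0)) (coordPrior H (σ k)) x)
        ∂(gaussianReal (f₀ k) (1 / (n : ℝ≥0)))) / ENNReal.ofReal (δ ^ 2) := by
  have hδ2 : ENNReal.ofReal (δ ^ 2) ≠ 0 := by
    rw [Ne, ENNReal.ofReal_eq_zero, not_le]; positivity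
  have hm : ∀ k, Measurable fun f : ℕ+ → ℝ => ENNReal.ofReal ((f k - f₀ k) ^ 2) := fun k => by
    fun_prop
  have hsub : {f | ENNReal.ofReal δ < l2norm (f - f₀)} ⊆
      {f | ENNReal.ofReal (δ ^ 2) ≤ ∑' k, ENNReal.ofReal ((f k - f₀ k) ^ 2)} := by
    intro f hf
    have h1 : ENNReal.ofReal δ ≤ (∑' k, ENNReal.ofReal ((f k - f₀ k) ^ 2)) ^ (1 / 2 : ℝ) := hf.le
    show ENNReal.ofReal (δ ^ 2) ≤ _
    have h2 := ENNReal.rpow_le_rpow h1 two_pos.le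
    rw [← ENNReal.rpow_mul] at h2
    norm_num at h2
    rwa [ENNReal.ofReal_pow hδ.le]
  calc _ ≤ ∫⁻ X, (∫⁻ f, ∑' k, ENNReal.ofReal ((f k - f₀ k) ^ 2)
            ∂(posteriorLaw n (prior H σ) X)) / ENNReal.ofReal (δ ^ 2) ∂(dataLaw n f₀) :=
        lintegral_mono fun X => (measure_mono hsub).trans
          (meas_ge_le_lintegral_div (Measurable.tsum hm).aemeasurable hδ2
            ENNReal.ofReal_ne_top)
    _ = (∫⁻ X, ∫⁻ f, ∑' k, ENNReal.ofReal ((f k - f₀ k) ^ 2)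
            ∂(posteriorLaw n (prior H σ) X) ∂(dataLaw n f₀)) / ENNReal.ofReal (δ ^ 2) := by
        simp_rw [div_eq_mul_inv]
        rw [lintegral_mul_const' _ _ (ENNReal.inv_ne_top.2 hδ2)]
    _ = _ := by
        congr 1
        simp_rw [lintegral_tsum fun k => (hm k).aemeasurable]
        rw [lintegral_tsum fun k => (Measurable.lintegral_kernel (hm k)).aemeasurable]
        refine tsum_congr fun k => ?_
        exact lintegral_posteriorLaw_eval hn H hσ hH hf₀ k
          (g := fun θ => ENNReal.ofReal ((θ - f₀ k) ^ 2)) (by fun_prop)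

theorem one_le_rpow_cast {c : ℝ} (hc : 0 ≤ c) (k : ℕ+) : 1 ≤ (k : ℝ) ^ c :=
  Real.one_le_rpow (by exact_mod_cast (one_le : 1 ≤ k)) hc

theorem summable_sq_of_mem_sobolevBall {β L : ℝ} (hβ : 0 < β) {f : ℕ+ → ℝ}
    (hf : f ∈ sobolevBall β L) : Summable fun k => f k ^ 2 :=
  Summable.of_nonneg_of_le (fun _ => sq_nonneg _)
    (fun k => le_mul_of_one_le_left (sq_nonneg _) (one_le_rpow_cast (by positivity) k)) hf.1

theorem abs_le_of_mem_sobolevBall {β L : ℝ} (hβ : 0 < β) (hL : 0 < L) {f : ℕ+ → ℝ}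
    (hf : f ∈ sobolevBall β L) (k : ℕ+) : |f k| ≤ L := by
  refine abs_le_of_sq_le_sq ?_ hL.le
  calc f k ^ 2 ≤ (k : ℝ) ^ (2 * β) * f k ^ 2 :=
        le_mul_of_one_le_left (sq_nonneg _) (one_le_rpow_cast (by positivity) k)
    _ ≤ ∑' k : ℕ+, (k : ℝ) ^ (2 * β) * f k ^ 2 :=
        hf.1.le_tsum k fun j _ => by positivity
    _ ≤ L ^ 2 := hf.2

theorem tsum_tail_sq_le {β L : ℝ} (hβ : 0 < β) {f : ℕ+ → ℝ} (hf : f ∈ sobolevBall β L) {K : ℝ}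
    (hK : 0 < K) :
    ∑' k : ℕ+, (if (k : ℝ) ≤ K then 0 else ENNReal.ofReal (f k ^ 2)) ≤
      ENNReal.ofReal (L ^ 2 * K ^ (-(2 * β))) := by
  calc _ ≤ ∑' k : ℕ+, ENNReal.ofReal (K ^ (-(2 * β))) *
        ENNReal.ofReal ((k : ℝ) ^ (2 * β) * f k ^ 2) := by
        refine ENNReal.tsum_le_tsum fun k => ?_
        split_ifs with hk
        · exact zero_le
        · rw [← ENNReal.ofReal_mul (by positivity), ← mul_assoc]
          refine ENNReal.ofReal_le_ofReal (le_mul_of_one_le_left (sq_nonneg _) ?_)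
          rw [Real.rpow_neg hK.le, ← div_eq_inv_mul, one_le_div (by positivity)]
          exact Real.rpow_le_rpow hK.le (not_le.1 hk).le (by positivity)
    _ = ENNReal.ofReal (K ^ (-(2 * β))) *
        ENNReal.ofReal (∑' k : ℕ+, (k : ℝ) ^ (2 * β) * f k ^ 2) := by
        rw [ENNReal.tsum_mul_left, ENNReal.ofReal_tsum_of_nonneg (fun k => by positivity) hf.1]
    _ ≤ _ := by
        rw [mul_comm, ENNReal.ofReal_mul (sq_nonneg L)]
        gcongr
        exact hf.2

theorem summable_sq_of_le_rpow {β A : ℝ} (hβ : 0 < β) {τ : ℕ+ → ℝ}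
    (hτ : ∀ k, τ k ^ 2 ≤ A * (k : ℝ) ^ (-(1 + 2 * β))) : Summable fun k => τ k ^ 2 := by
  have h : Summable fun k : ℕ+ => (k : ℝ) ^ (-(1 + 2 * β)) :=
    (Real.summable_nat_rpow.2 (by linarith : -(1 + 2 * β) < -1)).comp_injective
      PNat.coe_injective
  exact Summable.of_nonneg_of_le (fun _ => sq_nonneg _) hτ (h.mul_left A)

/-- The sum of the coordinate risks is, up to a logarithmic factor, of the order of the minimax
rate. -/
theorem exists_tsum_coordRisk_le {H : Measure ℝ} [IsProbabilityMeasure H] {h : ℝ → ℝ} {c₁ κ : ℝ}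
    (hc₁ : 0 < c₁) (hκ : 0 ≤ κ) (hH : HasDensity H h) (hh : HeavyTailed h c₁ κ)
    (hmom : Integrable (fun x : ℝ => |x| ^ 2 * h x)) {β : ℝ} (hβ : 0 < β) {τ : ℕ+ → ℝ} {A B : ℝ}
    (hA : 0 ≤ A) (hB : 0 ≤ B) (hτ0 : ∀ k, 0 < τ k) (hτ1 : ∀ k, τ k ≤ 1)
    (hτA : ∀ k, τ k ^ 2 ≤ A * (k : ℝ) ^ (-(1 + 2 * β)))
    (hτB : ∀ k, Real.log (1 / τ k) ≤ B * (1 + Real.log k) ^ 2) {L : ℝ} (hL : 0 < L) :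
    ∃ C : ℝ, 0 ≤ C ∧ ∀ f₀ ∈ sobolevBall β L, ∀ n : ℕ, n ≠ 0 → ∀ σ : ℕ+ → ℝ,
      (∀ k, σ k = τ k ∨ σ k = 0) → (∀ k : ℕ+, (k : ℕ) ≤ n → σ k = τ k) →
      ∑' k, ∫⁻ x, ∫⁻ θ, ENNReal.ofReal ((θ - f₀ k) ^ 2)
        ∂(coordPosterior (1 / (n : ℝ≥0)) (coordPrior H (σ k)) x)
        ∂(gaussianReal (f₀ k) (1 / (n : ℝ≥0))) ≤
      ENNReal.ofReal ((4 * (4 + (Real.log n / 2 +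
        c₁ * (1 + (Real.log (2 + L) + B * (1 + Real.log n) ^ 2) ^ (1 + κ)))) + C) *
          (n : ℝ) ^ (-(2 * β) / (2 * β + 1))) := by
  obtain ⟨C₁, hC₁, hsmall⟩ := exists_coordRisk_le_of_small_scale hH hh hmom A
  obtain ⟨C₂, hC₂, htail⟩ := exists_tsum_tail_rpow_le (s := 2 * β) (by positivity)
  refine ⟨C₁ * (A * C₂ + L ^ 2), by positivity, fun f₀ hf₀ n hn σ hσ hσn => ?_⟩
  have hn1 : (1 : ℝ) ≤ n := by exact_mod_cast Nat.one_le_iff_ne_zero.2 hn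
  have hn0 : (0 : ℝ) < n := by linarith
  have hlogn : 0 ≤ Real.log n := Real.log_nonneg hn1
  have hlogL : 0 ≤ Real.log (2 + L) := Real.log_nonneg (by linarith)
  set v : ℝ≥0 := 1 / (n : ℝ≥0) with hv
  have hvr : (v : ℝ) = 1 / n := by simp [hv]
  have hv0 : v ≠ 0 := by simpa [hv] using hn
  have hv1 : v ≤ 1 := by
    rw [← NNReal.coe_le_coe, hvr, NNReal.coe_one, div_le_one hn0]
    exact hn1
  -- The cutoff balances accumulated noise and bias: `K / n = K^{-2β}`, both equal to `R` below.
  -- Since `K ≤ n`, no coordinate up to `K` is truncated.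
  set K : ℝ := (n : ℝ) ^ (1 / (2 * β + 1)) with hK
  have hK0 : 0 < K := by positivity
  have hKn : K ≤ n := by
    rw [hK]
    conv_rhs => rw [← Real.rpow_one (n : ℝ)]
    exact Real.rpow_le_rpow_of_exponent_le hn1 (by rw [div_le_one (by positivity)]; linarith)
  set R : ℝ := (n : ℝ) ^ (-(2 * β) / (2 * β + 1)) with hR
  have hR0 : 0 < R := by positivity
  have hKR : K ^ (-(2 * β)) = R := by
    rw [hK, hR, ← Real.rpow_mul hn0.le]
    congr 1
    ring
  have hKv : K * v = R := by
    rw [hK, hvr, hR, one_div (n : ℝ), ← Real.rpow_neg_one (n : ℝ), ← Real.rpow_add hn0]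
    congr 1
    field_simp
    ring
  set D : ℝ := 4 * (4 + (Real.log n / 2 +
        c₁ * (1 + (Real.log (2 + L) + B * (1 + Real.log n) ^ 2) ^ (1 + κ)))) with hD
  have hD0 : 0 ≤ D := by positivity
  have hlow : ∀ k : ℕ+, (k : ℝ) ≤ K →
      ∫⁻ x, ∫⁻ θ, ENNReal.ofReal ((θ - f₀ k) ^ 2) ∂(coordPosterior v (coordPrior H (σ k)) x)
        ∂(gaussianReal (f₀ k) v) ≤ ENNReal.ofReal (v * D) := by
    intro k hk
    have hkn : (k : ℝ) ≤ n := hk.trans hKn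
    have hk1 : (1 : ℝ) ≤ k := by exact_mod_cast (one_le : 1 ≤ k)
    rw [hσn k (by exact_mod_cast hkn)]
    have hlog : Real.log (1 / τ k) ≤ B * (1 + Real.log n) ^ 2 := by
      refine (hτB k).trans ?_
      have := Real.log_nonneg hk1
      gcongr
    refine (coordRisk_le hc₁ hκ hH hh hv0 hv1 (hτ0 k) (hτ1 k)
      (abs_le_of_mem_sobolevBall hβ hL hf₀ k) hlog).trans (le_of_eq ?_)
    rw [hD, hvr, one_div_one_div]
    congr 1
    ring
  have hhigh : ∀ k : ℕ+, ¬ (k : ℝ) ≤ K →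
      ∫⁻ x, ∫⁻ θ, ENNReal.ofReal ((θ - f₀ k) ^ 2) ∂(coordPosterior v (coordPrior H (σ k)) x)
        ∂(gaussianReal (f₀ k) v) ≤
      ENNReal.ofReal (C₁ * A) * ENNReal.ofReal ((k : ℝ) ^ (-(1 + 2 * β))) +
        ENNReal.ofReal C₁ * ENNReal.ofReal (f₀ k ^ 2) := by
    intro k hk
    have hk1 : (1 : ℝ) ≤ k := by exact_mod_cast (one_le : 1 ≤ k)
    have hk0 : (0 : ℝ) < k := by linarith
    have hσ0 : 0 ≤ σ k := by
      rcases hσ k with e | e <;> rw [e]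
      exact (hτ0 k).le
    have hσA : σ k ^ 2 ≤ A * (k : ℝ) ^ (-(1 + 2 * β)) := by
      rcases hσ k with e | e <;> rw [e]
      · exact hτA k
      · rw [zero_pow two_ne_zero]; positivity
    -- `K` is also the index where `k^{-(1+2β)}` falls to `1 / n`, so beyond it the bound for small
    -- scales applies with `T = A`.
    have hσv : σ k ^ 2 ≤ A * v := by
      refine hσA.trans ?_
      gcongr
      calc (k : ℝ) ^ (-(1 + 2 * β)) ≤ K ^ (-(1 + 2 * β)) :=
            Real.rpow_le_rpow_of_nonpos hK0 (not_le.1 hk).le (by linarith)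
        _ = v := by
            rw [hK, ← Real.rpow_mul hn0.le, hvr, one_div (n : ℝ), ← Real.rpow_neg_one]
            congr 1
            field_simp
            ring
    refine (hsmall v hv0 (σ k) (f₀ k) hσ0 hσv).trans ?_
    rw [← ENNReal.ofReal_mul (by positivity), ← ENNReal.ofReal_mul hC₁,
      ← ENNReal.ofReal_add (by positivity) (by positivity), mul_assoc, ← mul_add]
    gcongr
  calc _ ≤ ∑' k : ℕ+, ((if (k : ℝ) ≤ K then ENNReal.ofReal (v * D) else 0) +
        (ENNReal.ofReal (C₁ * A) *
            (if (k : ℝ) ≤ K then 0 else ENNReal.ofReal ((k : ℝ) ^ (-(1 + 2 * β)))) +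
          ENNReal.ofReal C₁ * (if (k : ℝ) ≤ K then 0 else ENNReal.ofReal (f₀ k ^ 2)))) := by
        refine ENNReal.tsum_le_tsum fun k => ?_
        by_cases hk : (k : ℝ) ≤ K
        · simpa [hk] using hlow k hk
        · simpa [hk] using hhigh k hk
    _ ≤ ENNReal.ofReal K * ENNReal.ofReal (v * D) +
        (ENNReal.ofReal (C₁ * A) * ENNReal.ofReal (C₂ * K ^ (-(2 * β))) +
          ENNReal.ofReal C₁ * ENNReal.ofReal (L ^ 2 * K ^ (-(2 * β)))) := by
        rw [ENNReal.tsum_add, ENNReal.tsum_add, ENNReal.tsum_mul_left, ENNReal.tsum_mul_left]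
        gcongr
        · exact tsum_ite_cast_le_mul_le K _
        · exact htail K hK0
        · exact tsum_tail_sq_le hβ hf₀ hK0
    _ = _ := by
        rw [hKR, ← ENNReal.ofReal_mul hK0.le, ← ENNReal.ofReal_mul (by positivity),
          ← ENNReal.ofReal_mul hC₁, ← ENNReal.ofReal_add (by positivity) (by positivity),
          ← ENNReal.ofReal_add (by positivity) (by positivity), ← mul_assoc, hKv]
        congr 1
        ring

/-- Here `x` is `log n`. The numerator is at most of order `x ^ (2 (1 + κ))`, and the squared radius
with `d = 2 + κ` contributes two more powers, so the quotient is at most of order `x⁻²`. -/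
theorem tendsto_log_factor_zero {c₁ κ B C l : ℝ} (hc₁ : 0 < c₁) (hκ : 0 ≤ κ) (hB : 0 ≤ B)
    (hC : 0 ≤ C) (hl : 0 ≤ l) :
    Tendsto (fun x : ℝ => (4 * (4 + (x / 2 +
      c₁ * (1 + (l + B * (1 + x) ^ 2) ^ (1 + κ)))) + C) / x ^ (2 * (2 + κ))) atTop (𝓝 0) := by
  set D := 4 * (5 + c₁ * (1 + (l + 4 * B) ^ (1 + κ))) + C with hD
  have hlim : Tendsto (fun x : ℝ => D * x ^ (-(2 : ℝ))) atTop (𝓝 0) := by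
    simpa using (tendsto_rpow_neg_atTop (two_pos : (0 : ℝ) < 2)).const_mul D
  refine tendsto_of_tendsto_of_tendsto_of_le_of_le' tendsto_const_nhds hlim ?_ ?_
  · filter_upwards [eventually_ge_atTop 1] with x hx
    positivity
  · filter_upwards [eventually_ge_atTop 1] with x hx
    have hx0 : 0 < x := by linarith
    rw [div_le_iff₀ (by positivity), mul_assoc, ← Real.rpow_add hx0]
    set y := x ^ (2 * (1 + κ)) with hy
    have e : x ^ (-2 + 2 * (2 + κ)) = y := by rw [hy]; congr 1; ring
    rw [e]
    have hy1 : 1 ≤ y := Real.one_le_rpow hx (by positivity)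
    have hxy : x ≤ y := by
      calc x = x ^ (1 : ℝ) := (Real.rpow_one x).symm
        _ ≤ y := Real.rpow_le_rpow_of_exponent_le hx (by linarith)
    have hpow : (l + B * (1 + x) ^ 2) ^ (1 + κ) ≤ (l + 4 * B) ^ (1 + κ) * y := by
      have e2 : y = (x ^ 2) ^ (1 + κ) := by
        rw [hy, Real.rpow_mul hx0.le]
        norm_num
      rw [e2, ← Real.mul_rpow (by positivity) (by positivity)]
      refine Real.rpow_le_rpow (by positivity) ?_ (by positivity)
      have h1 : (1 + x) ^ 2 ≤ 4 * x ^ 2 := by nlinarith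
      have h2 : 1 ≤ x ^ 2 := one_le_pow₀ hx
      nlinarith [mul_le_mul_of_nonneg_left h1 hB, mul_le_mul_of_nonneg_left h2 hl]
    have h3 := mul_le_mul_of_nonneg_left hpow hc₁.le
    have h4 := mul_le_mul_of_nonneg_left hy1 hc₁.le
    have h5 := mul_le_mul_of_nonneg_left hy1 hC
    rw [hD]
    nlinarith

/-- Posterior contraction for scales between `exp (-B (1 + log k)²)` and `k ^ (-1/2 - β)`, which may
be truncated at `k = n`. -/
theorem contractsAt_of_scale {H : Measure ℝ} [IsProbabilityMeasure H] {h : ℝ → ℝ} {c₁ κ : ℝ}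
    (hc₁ : 0 < c₁) (hκ : 0 ≤ κ) (hH : HasDensity H h) (hh : HeavyTailed h c₁ κ)
    (hmom : Integrable (fun x : ℝ => |x| ^ 2 * h x)) {β : ℝ} (hβ : 0 < β) {τ : ℕ+ → ℝ} {A B : ℝ}
    (hA : 0 ≤ A) (hB : 0 ≤ B) (hτ0 : ∀ k, 0 < τ k) (hτ1 : ∀ k, τ k ≤ 1)
    (hτA : ∀ k, τ k ^ 2 ≤ A * (k : ℝ) ^ (-(1 + 2 * β)))
    (hτB : ∀ k, Real.log (1 / τ k) ≤ B * (1 + Real.log k) ^ 2) {σ : ℕ → ℕ+ → ℝ}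
    (hσ : ∀ n k, σ n k = τ k ∨ σ n k = 0) (hσn : ∀ n, ∀ k : ℕ+, (k : ℕ) ≤ n → σ n k = τ k)
    {L : ℝ} (hL : 0 < L) {f₀ : ℕ+ → ℝ} (hf₀ : f₀ ∈ sobolevBall β L) :
    ContractsAt (fun n => prior H (σ n)) f₀ β (2 + κ) := by
  obtain ⟨C, hC, hrisk⟩ := exists_tsum_coordRisk_le hc₁ hκ hH hh hmom hβ hA hB hτ0 hτ1 hτA hτB hL
  have hmom2 : ∫⁻ x, ENNReal.ofReal (x ^ 2) ∂H ≠ ∞ := by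
    rw [← ofReal_integral_eq_lintegral_ofReal (hH.integrable_sq hh hmom)
      (ae_of_all _ fun _ => sq_nonneg _)]
    exact ENNReal.ofReal_ne_top
  have hlim := ENNReal.tendsto_ofReal ((tendsto_log_factor_zero (l := Real.log (2 + L)) hc₁ hκ hB hC
    (Real.log_nonneg (by linarith))).comp
    (Real.tendsto_log_atTop.comp tendsto_natCast_atTop_atTop))
  rw [ENNReal.ofReal_zero] at hlim
  refine tendsto_of_tendsto_of_tendsto_of_le_of_le' tendsto_const_nhds hlim
    (Eventually.of_forall fun _ => zero_le) ?_
  filter_upwards [eventually_ge_atTop 2] with n hn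
  have hn1 : (1 : ℝ) < n := by exact_mod_cast hn
  have hn0 : (0 : ℝ) < n := by linarith
  have hlogn : 0 < Real.log n := Real.log_pos hn1
  have hσA : ∀ k, σ n k ^ 2 ≤ A * (k : ℝ) ^ (-(1 + 2 * β)) := fun k => by
    rcases hσ n k with e | e <;> rw [e]
    · exact hτA k
    · rw [zero_pow two_ne_zero]; positivity
  have hδ : 0 < Real.log n ^ (2 + κ) * (n : ℝ) ^ (-β / (2 * β + 1)) := by positivity
  refine (lintegral_posteriorLaw_le (by omega) H (summable_sq_of_le_rpow hβ hσA) hmom2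
    (summable_sq_of_mem_sobolevBall hβ hf₀) hδ).trans ?_
  refine (ENNReal.div_le_div_right (hrisk f₀ hf₀ n (by omega) (σ n) (hσ n) (hσn n)) _).trans ?_
  have hδ2 : (Real.log n ^ (2 + κ) * (n : ℝ) ^ (-β / (2 * β + 1))) ^ 2 =
      Real.log n ^ (2 * (2 + κ)) * (n : ℝ) ^ (-(2 * β) / (2 * β + 1)) := by
    rw [mul_pow, ← Real.rpow_mul_natCast hlogn.le, ← Real.rpow_mul_natCast hn0.le]
    congr 2
    · push_cast; ring
    · push_cast; ring
  rw [hδ2, ← ENNReal.ofReal_div_of_pos (by positivity), mul_div_mul_right _ _ (by positivity)]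
  exact le_rfl

end Contraction

/-! ### The two scale sequences and truncation -/

section Scales

theorem log_pnat_nonneg (k : ℕ+) : 0 ≤ Real.log k :=
  Real.log_nonneg (by exact_mod_cast (one_le : 1 ≤ k))

theorem scaleOT_le_one (k : ℕ+) : scaleOT k ≤ 1 :=
  Real.exp_le_one_iff.2 (neg_nonpos.2 (sq_nonneg _))

/-- With `t = log k` and `b = 1 + 2β` this is `-2t² ≤ b² - b t`. These scales decay faster than
every power of `k`, so every `β` is allowed, at the price of a constant depending on `β`. -/
theorem scaleOT_sq_le (β : ℝ) (k : ℕ+) :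
    scaleOT k ^ 2 ≤ Real.exp ((1 + 2 * β) ^ 2) * (k : ℝ) ^ (-(1 + 2 * β)) := by
  have hk : (0 : ℝ) < k := by exact_mod_cast k.pos
  rw [scaleOT, ← Real.exp_nat_mul, Real.rpow_def_of_pos hk, ← Real.exp_add, Real.exp_le_exp]
  push_cast
  nlinarith [sq_nonneg (Real.log k - (1 + 2 * β)), sq_nonneg (Real.log k),
    sq_nonneg (1 + 2 * β)]

theorem log_scaleOT_le (k : ℕ+) : Real.log (1 / scaleOT k) ≤ 1 * (1 + Real.log k) ^ 2 := by
  rw [one_div, Real.log_inv, scaleOT, Real.log_exp]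
  nlinarith [log_pnat_nonneg k]

theorem scaleHT_pos (α : ℝ) (k : ℕ+) : 0 < scaleHT α k :=
  Real.rpow_pos_of_pos (by exact_mod_cast k.pos) _

theorem scaleHT_le_one {α : ℝ} (hα : 0 ≤ α) (k : ℕ+) : scaleHT α k ≤ 1 :=
  Real.rpow_le_one_of_one_le_of_nonpos (by exact_mod_cast (one_le : 1 ≤ k)) (by linarith)

/-- The condition `β ≤ α` ensures that the scales fall to the noise level no later than the cutoff
for smoothness `β`. -/
theorem scaleHT_sq_le {α β : ℝ} (hβα : β ≤ α) (k : ℕ+) :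
    scaleHT α k ^ 2 ≤ 1 * (k : ℝ) ^ (-(1 + 2 * β)) := by
  rw [scaleHT, ← Real.rpow_mul_natCast (by positivity), one_mul]
  refine Real.rpow_le_rpow_of_exponent_le (by exact_mod_cast (one_le : 1 ≤ k)) ?_
  push_cast
  linarith

theorem log_scaleHT_le {α : ℝ} (hα : 0 ≤ α) (k : ℕ+) :
    Real.log (1 / scaleHT α k) ≤ (1 / 2 + α) * (1 + Real.log k) ^ 2 := by
  rw [one_div, Real.log_inv, scaleHT, Real.log_rpow (by exact_mod_cast k.pos)]
  have h1 : Real.log k ≤ (1 + Real.log k) ^ 2 := by nlinarith [log_pnat_nonneg k]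
  have h2 : 0 ≤ 1 / 2 + α := by linarith
  linarith [mul_le_mul_of_nonneg_left h1 h2]

theorem truncate_eq_or (σ : ℕ+ → ℝ) (n : ℕ) (k : ℕ+) :
    truncate n σ k = σ k ∨ truncate n σ k = 0 := by
  unfold truncate; split_ifs <;> simp

theorem truncate_of_le (σ : ℕ+ → ℝ) (n : ℕ) (k : ℕ+) (h : (k : ℕ) ≤ n) : truncate n σ k = σ k :=
  if_pos h

end Scales

end HeavyTailedSeries

theorem theorem1 (H : Measure ℝ) [IsProbabilityMeasure H] (h : ℝ → ℝ) (c₁ κ : ℝ)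
    (hc₁ : 0 < c₁) (hκ : 0 ≤ κ)
    (hH : HeavyTailedSeries.HasDensity H h)
    (hh : HeavyTailedSeries.HeavyTailed h c₁ κ)
    (hmom : Integrable (fun x : ℝ => |x| ^ 2 * h x)) :
    (∀ β : ℝ, 0 < β → ∃ d : ℝ, 0 < d ∧
      ∀ L : ℝ, 0 < L → ∀ f₀ ∈ HeavyTailedSeries.sobolevBall β L,
        HeavyTailedSeries.ContractsAt
          (fun _ => HeavyTailedSeries.prior H HeavyTailedSeries.scaleOT) f₀ β d ∧
        HeavyTailedSeries.ContractsAt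
          (fun n => HeavyTailedSeries.prior H
            (HeavyTailedSeries.truncate n HeavyTailedSeries.scaleOT)) f₀ β d) ∧
    (∀ α β : ℝ, 0 < β → β ≤ α → ∃ d : ℝ, 0 < d ∧
      ∀ L : ℝ, 0 < L → ∀ f₀ ∈ HeavyTailedSeries.sobolevBall β L,
        HeavyTailedSeries.ContractsAt
          (fun _ => HeavyTailedSeries.prior H (HeavyTailedSeries.scaleHT α)) f₀ β d ∧
        HeavyTailedSeries.ContractsAt
          (fun n => HeavyTailedSeries.prior H
            (HeavyTailedSeries.truncate n (HeavyTailedSeries.scaleHT α))) f₀ β d) := by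
  -- The same exponent `2 + κ` serves all four cases: the bound `log² k` for `log (1 / σ_k)` covers
  -- both scale sequences, and truncation leaves the rate bound unchanged.
  refine ⟨fun β hβ => ⟨2 + κ, by positivity, fun L hL f₀ hf₀ => ⟨?_, ?_⟩⟩,
    fun α β hβ hβα => ⟨2 + κ, by positivity, fun L hL f₀ hf₀ => ⟨?_, ?_⟩⟩⟩
  · exact HeavyTailedSeries.contractsAt_of_scale hc₁ hκ hH hh hmom hβ (Real.exp_nonneg _)
      zero_le_one (fun _ => Real.exp_pos _) HeavyTailedSeries.scaleOT_le_one
      (HeavyTailedSeries.scaleOT_sq_le β) HeavyTailedSeries.log_scaleOT_le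
      (fun _ _ => .inl rfl) (fun _ _ _ => rfl) hL hf₀
  · exact HeavyTailedSeries.contractsAt_of_scale hc₁ hκ hH hh hmom hβ (Real.exp_nonneg _)
      zero_le_one (fun _ => Real.exp_pos _) HeavyTailedSeries.scaleOT_le_one
      (HeavyTailedSeries.scaleOT_sq_le β) HeavyTailedSeries.log_scaleOT_le
      (HeavyTailedSeries.truncate_eq_or _) (HeavyTailedSeries.truncate_of_le _) hL hf₀
  · have hα : 0 ≤ α := hβ.le.trans hβα
    exact HeavyTailedSeries.contractsAt_of_scale hc₁ hκ hH hh hmom hβ zero_le_one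
      (by positivity) (HeavyTailedSeries.scaleHT_pos α) (HeavyTailedSeries.scaleHT_le_one hα)
      (HeavyTailedSeries.scaleHT_sq_le hβα) (HeavyTailedSeries.log_scaleHT_le hα)
      (fun _ _ => .inl rfl) (fun _ _ _ => rfl) hL hf₀
  · have hα : 0 ≤ α := hβ.le.trans hβα
    exact HeavyTailedSeries.contractsAt_of_scale hc₁ hκ hH hh hmom hβ zero_le_one
      (by positivity) (HeavyTailedSeries.scaleHT_pos α) (HeavyTailedSeries.scaleHT_le_one hα)
      (HeavyTailedSeries.scaleHT_sq_le hβα) (HeavyTailedSeries.log_scaleHT_le hα)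
      (HeavyTailedSeries.truncate_eq_or _) (HeavyTailedSeries.truncate_of_le _) hL hf₀
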